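/- Let $\mathcal Z$ be a compact metric space, $\mu$ a Borel probability measure on $\mathcal Z$ with support $\mathcal Z$, $n,p\ge 1$ integers, $\sigma_x,\gamma\ge 0$. Consider the three mutually independent sources of randomness of the Latent Metric Model $\mathbf x_i=\boldsymbol\psi(z_i)+\sigma_x\mathbf e_i$, $1\le i\le n$: i.i.d. latent variables $z_1,\dots,z_n\sim\mu$; jointly measurable real-valued random functions $\psi_1,\dots,\psi_p$ on $\mathcal Z$; and i.i.d. noise vectors $\mathbf e_1,\dots,\mathbf e_n\in\mathbb R^p$ with independent, zero-mean, unit-variance entries, written as the $n\times p$ matrix $\mathbf E=[\mathbf e_1|\cdots|\mathbf e_n]^\top$. Assume that $\psi_1,\dots,\psi_p$ are mutually independent, pointwise square integrable and mean-square continuous, that $\sup_{j}\sup_{z}\mathbb E|\psi_j(z)|^4<\infty$ and that $\mathbb E|\mathbf E_{ij}|^4<\infty$ for all $i,j$. Let $f(z,z')=p^{-1}\,\mathbb E\langle\boldsymbol\psi(z),\boldsymbol\psi(z')\rangle$, and let $\lambda_1\ge\lambda_2\ge\cdots\ge 0$ be the eigenvalues, counted with multiplicity (and padded with zeros if only finitely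 many are nonzero), of the integral operator on $L_2(\mu)$ with kernel $f$, with $L_2(\mu)$-orthonormal (continuous) eigenfunctions $u_k$ for the nonzero $\lambda_k$, these eigenvalues and eigenfunctions exhausting the nonzero part of the spectrum. Assume $\sum_{k\ge1}k\lambda_k<\infty$. Put $\phi(z)=[\lambda_1^{1/2}u_1(z)\;\lambda_2^{1/2}u_2(z)\;\cdots]^\top$, $\boldsymbol\Phi=[\phi(z_1)|\cdots|\phi(z_n)]^\top$, let $\boldsymbol\Phi_{>k}$ be $\boldsymbol\Phi$ without its first $k$ columns, $\mathbf K_{>k}=\boldsymbol\Phi_{>k}\boldsymbol\Phi_{>k}^\top$ (so $\mathbf K_{>0}=\boldsymbol\Phi\boldsymbol\Phi^\top$), and let $\mathbf W$ have entries $\mathbf W_{jk}=(\lambda_kp)^{-1/2}\int_{\mathcal Z}\psi_j(z)u_k(z)\,\mu(\mathrm dz)$ for $1\le j\le p$, $k\ge 1$ ($\mathbf W_{jk}=0$ if $\lambda_k=0$). Let $$\boldsymbol\Delta=\boldsymbol\Phi(\mathbf W^\top\mathbf W-\mathbf I)\boldsymbol\Phi^\top+p^{-1/2}\sigma_x(\boldsymbol\Phi\mathbf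 W^\top\mathbf E^\top+\mathbf E\mathbf W\boldsymbol\Phi^\top)+p^{-1}\sigma_x^2(\mathbf E\mathbf E^\top-p\,\mathbf I_n),$$ the infinite products being limits, as $N\to\infty$, of the products over the first $N$ columns of $\boldsymbol\Phi$ and $\mathbf W$. Write $\mu_n(\cdot)$ for the smallest eigenvalue of a symmetric $n\times n$ matrix and $\|\cdot\|_2$ for the spectral norm, and let $$C^{(k)}_{p,n}=\{2\|\boldsymbol\Delta\|_2\ge\mu_n(\mathbf K_{>k})+\sigma_x^2+n\gamma\},$$ $$v_1=\sup_{z,z'}\frac1p\sum_{j=1}^p\mathrm{Var}[\psi_j(z)\psi_j(z')],\qquad v_2=\sup_z\frac1p\sum_{j=1}^p\mathbb E|\psi_j(z)|^2,\qquad v_3=\sup_{i,j}\mathbb E|\mathbf E_{ij}|^4$$ ($v_3=\mathbb E|\mathbf E_{11}|^4$ if the entries of $\mathbf E$ are identically distributed). Then the limits defining $\boldsymbol\Delta$ exist almost surely, $C^{(k)}_{p,n}$ is an event (up to null sets), and for every $0\le k\le n$: (i) almost surely, whenever $\mu_n(\mathbf K_{>k})+\sigma_x^2+n\gamma>0$,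 $$\mathbb P\bigl(C^{(k)}_{p,n}\,\big|\,z_1,\dots,z_n\bigr)\le\frac{24n^2}{p}\,\frac{v_1+8\sigma_x^2v_2+2\sigma_x^4v_3}{(\mu_n(\mathbf K_{>k})+\sigma_x^2+n\gamma)^2};$$ (ii) for every number $\phi_k(n)\ge0$ with $\phi_k(n)+\sigma_x^2+n\gamma>0$, $$1-\mathbb P\bigl(C^{(k)}_{p,n}\bigr)\ge\left(1-\frac{24n^2}{p}\,\frac{v_1+8\sigma_x^2v_2+2\sigma_x^4v_3}{(\phi_k(n)+\sigma_x^2+n\gamma)^2}\right)\mathbb P\bigl(\mu_n(\mathbf K_{>k})\ge\phi_k(n)\bigr).$$ -/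

import Mathlib

open MeasureTheory ProbabilityTheory Filter Topology

noncomputable section

namespace LMM

/-- The three independent sources of randomness of the Latent Metric Model
`x i = (ψ 1 (z i), …, ψ p (z i)) + σ • e i`:
* latent variables `z i`, i.i.d. with law `μ`;
* random functions `ψ j : Ω → (Z → ℝ)`, jointly measurable so that the path integrals
  `∫ ψ j (z) u (z) μ(dz)` are random variables; the σ-algebra on `Z → ℝ` is the product one;
* noise vectors `e i = (E i 1, …, E i p)`, i.i.d. over `i`, with independent centred entries of
  unit variance. Independence of the rows and of the entries of each row is the same as
  independence of the whole array.
The last two fields say that the three sources are mutually independent. -/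
structure IsLatentMetricModel {Ω Z : Type*} [MeasurableSpace Ω] [MeasurableSpace Z] {n p : ℕ}
    (P : Measure Ω) (μ : Measure Z) (z : Fin n → Ω → Z)
    (ψ : Fin p → Ω → Z → ℝ) (E : Fin n → Fin p → Ω → ℝ) : Prop where
  measurable_z : ∀ i, Measurable (z i)
  law_z : ∀ i, P.map (z i) = μ
  indep_z : iIndepFun z P
  measurable_ψ : ∀ j, Measurable (fun q : Ω × Z => ψ j q.1 q.2)
  measurable_E : ∀ i j, Measurable (E i j)
  indep_E : iIndepFun (fun q : Fin n × Fin p => E q.1 q.2) P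
  identDistrib_E : ∀ i i' j, IdentDistrib (E i j) (E i' j) P P
  mean_E : ∀ i j, P[E i j] = 0
  memLp_E : ∀ i j, MemLp (E i j) 2 P
  var_E : ∀ i j, Var[E i j; P] = 1
  indep_z_ψE : IndepFun (fun ω i => z i ω) (fun ω => (fun j => ψ j ω, fun i j => E i j ω)) P
  indep_ψ_E : IndepFun (fun ω j => ψ j ω) (fun ω i j => E i j ω) P

/-- The random functions are pointwise square integrable and mean-square continuous. -/
def MeanSquareContinuous {Ω Z : Type*} [MeasurableSpace Ω] [TopologicalSpace Z] {p : ℕ}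
    (P : Measure Ω) (ψ : Fin p → Ω → Z → ℝ) : Prop :=
  ∀ j x, MemLp (fun ω => ψ j ω x) 2 P ∧
    Tendsto (fun x' => ∫ ω, |ψ j ω x - ψ j ω x'| ^ 2 ∂P) (𝓝 x) (𝓝 0)

/-- Uniformly bounded fourth moments of the random functions, and finite fourth moments of the
noise. -/
def FourthMoments {Ω Z : Type*} [MeasurableSpace Ω] {n p : ℕ}
    (P : Measure Ω) (ψ : Fin p → Ω → Z → ℝ) (E : Fin n → Fin p → Ω → ℝ) : Prop :=
  (∃ M : ℝ, ∀ j x, MemLp (fun ω => ψ j ω x) 4 P ∧ ∫ ω, |ψ j ω x| ^ 4 ∂P ≤ M) ∧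
    ∀ i j, MemLp (E i j) 4 P

/-- The implicit kernel `(x, x') ↦ p⁻¹ 𝔼⟨ψ(x), ψ(x')⟩`. -/
def implicitKernel {Ω Z : Type*} [MeasurableSpace Ω] {p : ℕ} (P : Measure Ω) (ψ : Fin p → Ω → Z → ℝ)
    (x x' : Z) : ℝ :=
  (1 / (p : ℝ)) * ∫ ω, ∑ j, ψ j ω x * ψ j ω x' ∂P

/-- `lam 0 ≥ lam 1 ≥ … ≥ 0` are the eigenvalues, counted with multiplicity, of the integral
operator on `L²(μ)` with kernel `f`, padded with zeros if there are finitely many positive ones,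
and the `u k` with `lam k > 0` are corresponding orthonormal eigenfunctions. The eigenfunction
equation holds at every point, that is, `u k` is the continuous version when `f` is continuous.
The last field says that no positive eigenvalue is missing: a function orthogonal to all these
eigenfunctions is in the kernel of the operator. For `lam k = 0` the function `u k` plays no role,
so nothing is required of it (`L²(μ)` may have finite dimension). -/
structure IsEigensystem {Z : Type*} [MeasurableSpace Z] (μ : Measure Z) (f : Z → Z → ℝ)
    (lam : ℕ → ℝ) (u : ℕ → Z → ℝ) : Prop where
  nonneg : ∀ k, 0 ≤ lam k
  antitone : Antitone lam
  memLp : ∀ k, 0 < lam k → MemLp (u k) 2 μ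
  orthonormal : ∀ k l, 0 < lam k → 0 < lam l →
    ∫ x, u k x * u l x ∂μ = if k = l then 1 else 0
  eigen : ∀ k, 0 < lam k → ∀ x, ∫ x', f x x' * u k x' ∂μ = lam k * u k x
  complete : ∀ h : Z → ℝ, MemLp h 2 μ → (∀ k, 0 < lam k → ∫ x, h x * u k x ∂μ = 0) →
    ∀ᵐ x ∂μ, ∫ x', f x x' * h x' ∂μ = 0

/-- The `k`-th coordinate (from `0`) of the feature map, `φ(x) = (lam k ^ (1/2) * u k x)_k`. -/
def feature {Z : Type*} (lam : ℕ → ℝ) (u : ℕ → Z → ℝ) (k : ℕ) (x : Z) : ℝ := √(lam k) * u k x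

/-- The entries `(lam k * p) ^ (-1/2) * ∫ ψ j (x) u k (x) μ(dx)` of the random matrix `W`, which
are `0` if `lam k = 0`. -/
def W {Ω Z : Type*} [MeasurableSpace Z] {p : ℕ} (μ : Measure Z) (ψ : Fin p → Ω → Z → ℝ) (lam : ℕ → ℝ)
    (u : ℕ → Z → ℝ) (ω : Ω) (j : Fin p) (k : ℕ) : ℝ :=
  if lam k = 0 then 0 else (√(lam k * p))⁻¹ * ∫ x, ψ j ω x * u k x ∂μ

/-- The first `N` columns of `Φ = [φ(z 1) | … | φ(z n)]ᵀ`. -/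
def PhiTrunc {Ω Z : Type*} {n : ℕ} (z : Fin n → Ω → Z) (lam : ℕ → ℝ)
    (u : ℕ → Z → ℝ) (N : ℕ) (ω : Ω) : Matrix (Fin n) (Fin N) ℝ :=
  Matrix.of fun i k => feature lam u k (z i ω)

/-- The first `N` columns of `W`. -/
def WTrunc {Ω Z : Type*} [MeasurableSpace Z] {p : ℕ} (μ : Measure Z) (ψ : Fin p → Ω → Z → ℝ)
    (lam : ℕ → ℝ) (u : ℕ → Z → ℝ) (N : ℕ) (ω : Ω) : Matrix (Fin p) (Fin N) ℝ :=
  Matrix.of fun j k => W μ ψ lam u ω j k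

/-- The noise matrix `E = [e 1 | … | e n]ᵀ`. -/
def noiseMatrix {Ω : Type*} {n p : ℕ} (E : Fin n → Fin p → Ω → ℝ) (ω : Ω) :
    Matrix (Fin n) (Fin p) ℝ :=
  Matrix.of fun i j => E i j ω

open scoped Matrix in
/-- `Φ (Wᵀ W - I) Φᵀ + p^(-1/2) σ (Φ Wᵀ Eᵀ + E W Φᵀ) + p⁻¹ σ² (E Eᵀ - p I)`, with the
infinite products over the columns of `Φ` and `W` cut off at the first `N` columns. -/
def DeltaTrunc {Ω Z : Type*} [MeasurableSpace Z] {n p : ℕ} (μ : Measure Z)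
    (z : Fin n → Ω → Z) (ψ : Fin p → Ω → Z → ℝ)
    (E : Fin n → Fin p → Ω → ℝ) (σ : ℝ) (lam : ℕ → ℝ) (u : ℕ → Z → ℝ) (N : ℕ) (ω : Ω) :
    Matrix (Fin n) (Fin n) ℝ :=
  let F := PhiTrunc z lam u N ω
  let V := WTrunc μ ψ lam u N ω
  let e := noiseMatrix E ω
  F * (Vᵀ * V - 1) * Fᵀ + ((√(p : ℝ))⁻¹ * σ) • (F * Vᵀ * eᵀ + e * V * Fᵀ)
    + ((p : ℝ)⁻¹ * σ ^ 2) • (e * eᵀ - (p : ℝ) • (1 : Matrix (Fin n) (Fin n) ℝ))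

/-- The matrix
`Δ = Φ (Wᵀ W - I) Φᵀ + p^(-1/2) σ (Φ Wᵀ Eᵀ + E W Φᵀ) + p⁻¹ σ² (E Eᵀ - p I)`,
the infinite products being limits of partial sums, entry by entry. -/
def Delta {Ω Z : Type*} [MeasurableSpace Z] {n p : ℕ} (μ : Measure Z)
    (z : Fin n → Ω → Z) (ψ : Fin p → Ω → Z → ℝ)
    (E : Fin n → Fin p → Ω → ℝ) (σ : ℝ) (lam : ℕ → ℝ) (u : ℕ → Z → ℝ) (ω : Ω) :
    Matrix (Fin n) (Fin n) ℝ :=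
  Matrix.of fun i i' => limUnder atTop (fun N => DeltaTrunc μ z ψ E σ lam u N ω i i')

/-- `K_{>k} = Φ_{>k} Φ_{>k}ᵀ`, where `Φ_{>k}` is `Φ` without its first `k` columns; for `k = 0`
it is `K = Φ Φᵀ`. -/
def KTail {Ω Z : Type*} {n : ℕ} (z : Fin n → Ω → Z) (lam : ℕ → ℝ) (u : ℕ → Z → ℝ)
    (k : ℕ) (ω : Ω) : Matrix (Fin n) (Fin n) ℝ :=
  Matrix.of fun i i' => ∑' l : ℕ, feature lam u (k + l) (z i ω) * feature lam u (k + l) (z i' ω)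

theorem KTail_isHermitian {Ω Z : Type*} {n : ℕ} (z : Fin n → Ω → Z) (lam : ℕ → ℝ)
    (u : ℕ → Z → ℝ) (k : ℕ) (ω : Ω) : (KTail z lam u k ω).IsHermitian := by
  ext i i'
  simp only [KTail, Matrix.conjTranspose_apply, Matrix.of_apply, star_trivial]
  exact tsum_congr fun l => mul_comm _ _

/-- The `i`-th largest eigenvalue (`i = 1, …, n`) of a symmetric `n × n` matrix;
`Matrix.IsHermitian.eigenvalues₀` lists the eigenvalues in decreasing order, from index `0`. -/
def eigenvalueNth {n : ℕ} {B : Matrix (Fin n) (Fin n) ℝ} (hB : B.IsHermitian) (i : ℕ)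
    (hi : 1 ≤ i ∧ i ≤ n) : ℝ :=
  hB.eigenvalues₀ ⟨i - 1, by rw [Fintype.card_fin]; omega⟩

/-- `μ_n(K_{>k})`, the smallest eigenvalue of `K_{>k}`. -/
def muTail {Ω Z : Type*} {n : ℕ} (hn : 0 < n) (z : Fin n → Ω → Z) (lam : ℕ → ℝ)
    (u : ℕ → Z → ℝ) (k : ℕ) (ω : Ω) : ℝ :=
  eigenvalueNth (KTail_isHermitian z lam u k ω) n ⟨hn, le_rfl⟩

/-- The spectral norm of a square matrix. -/
def spectralNorm {n : ℕ} (B : Matrix (Fin n) (Fin n) ℝ) : ℝ :=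
  ‖Matrix.toEuclideanCLM (n := Fin n) (𝕜 := ℝ) B‖

/-- The event `C = {2 ‖Δ‖₂ ≥ μ_n(K_{>k}) + σ² + n γ}`. -/
def eventC {Ω Z : Type*} [MeasurableSpace Z] {n p : ℕ} (hn : 0 < n) (μ : Measure Z)
    (z : Fin n → Ω → Z) (ψ : Fin p → Ω → Z → ℝ)
    (E : Fin n → Fin p → Ω → ℝ) (σ γ : ℝ) (lam : ℕ → ℝ) (u : ℕ → Z → ℝ) (k : ℕ) : Set Ω :=
  {ω | 2 * spectralNorm (Delta μ z ψ E σ lam u ω) ≥ muTail hn z lam u k ω + σ ^ 2 + n * γ}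

/-- `v₁ = sup_{x, x'} p⁻¹ ∑_j Var[ψ j (x) ψ j (x')]`. -/
def v₁ {Ω Z : Type*} [MeasurableSpace Ω] {p : ℕ} (P : Measure Ω) (ψ : Fin p → Ω → Z → ℝ) : ℝ :=
  ⨆ q : Z × Z, (1 / (p : ℝ)) * ∑ j, Var[fun ω => ψ j ω q.1 * ψ j ω q.2; P]

/-- `v₂ = sup_x p⁻¹ ∑_j 𝔼|ψ j (x)|²`. -/
def v₂ {Ω Z : Type*} [MeasurableSpace Ω] {p : ℕ} (P : Measure Ω) (ψ : Fin p → Ω → Z → ℝ) : ℝ :=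
  ⨆ x : Z, (1 / (p : ℝ)) * ∑ j, ∫ ω, |ψ j ω x| ^ 2 ∂P

/-- `v₃ = sup_{i, j} 𝔼|E i j|⁴`, the common value of the fourth moments if the entries are
identically distributed. -/
def v₃ {Ω : Type*} [MeasurableSpace Ω] {n p : ℕ} (P : Measure Ω) (E : Fin n → Fin p → Ω → ℝ) : ℝ :=
  ⨆ q : Fin n × Fin p, ∫ ω, |E q.1 q.2 ω| ^ 4 ∂P

/-- The σ-algebra generated by `z 1, …, z n`. -/
abbrev sigmaZ {Ω Z : Type*} [MeasurableSpace Z] {n : ℕ} (z : Fin n → Ω → Z) : MeasurableSpace Ω :=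
  MeasurableSpace.comap (fun ω i => z i ω) inferInstance

end LMM

end

set_option linter.unusedSectionVars false

noncomputable section

/-! For frozen points `x`, `x'` in place of `z i`, `z i'`, the entry of Δ is p⁻¹ times the sum of
three centred terms: ∑ⱼ ψⱼ(x)ψⱼ(x') − p f(x, x'), σ times two signal-noise products, and σ² times ∑ⱼ
EᵢⱼEᵢ'ⱼ − p δ. Independence over j makes each second moment O(p), so the entry has second moment at
most 3(v₁ + 4σ²v₂ + σ⁴v₃)/p (`lintegral_perturbationEntry_sq_le`). The spectral norm is at most the
Frobenius norm, a sum over n² entries, so a conditional Chebyshev inequality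
(`condExp_indicator_le_div_sq`) gives (i), even with room in the constants. Integrating (i) over
{μ_n ≥ φ} gives (ii).

Two points need care. The first is convergence. Truncated at N columns, Φ Wᵀ is p^(-1/2) times the
partial eigenfunction expansions of the ψⱼ. The kernel is the averaged covariance, so completeness
forces almost every path into the span of the eigenfunctions, and coefficients satisfy 𝔼 c² ≤ p λₖ.
The integrated mean square error after N terms is thus at most p ∑_{k ≥ N} λₖ; summed over N this is
p ∑ (k+1) λₖ < ∞. Hence at μ-almost every point the errors are summable, and the expansion converges
both almost surely and in mean square (`ae_tsum_lintegral_sub_partialSum`).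

The second is conditioning. Independence of latent variables and paths is given for the product
σ-algebra on paths, for which evaluation at a variable point need not be measurable. Δ is therefore
rewritten as a measurable function of the latent variables, the noise and the countably many
coefficients ∫ ψⱼ eₖ dμ. Mean-square continuity makes these almost surely measurable functions of
the path (`exists_measurable_path_integral`), so the latent variables can be frozen by Fubini
(`setLIntegral_comp_le_of_indepFun`). -/

namespace LMM

open scoped ENNReal

/-! ### Path integrals of processes with bounded second moments. -/

section SecondOrder

variable {Ω Z : Type*} [MeasurableSpace Ω] [MeasurableSpace Z] {P : Measure Ω}
  [IsProbabilityMeasure P] {μ : Measure Z} [IsProbabilityMeasure μ] {X : Ω → Z → ℝ} {M : ℝ}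

theorem abs_mul_le_half_sq_add_sq (a b : ℝ) : |a * b| ≤ (a ^ 2 + b ^ 2) / 2 := by
  rw [abs_mul]
  nlinarith [sq_nonneg (|a| - |b|), sq_abs a, sq_abs b]

theorem integral_abs_mul_le_of_sq_le {f g : Ω → ℝ} (hf : MemLp f 2 P) (hg : MemLp g 2 P)
    (hfM : ∫ ω, f ω ^ 2 ∂P ≤ M) (hgM : ∫ ω, g ω ^ 2 ∂P ≤ M) : ∫ ω, |f ω * g ω| ∂P ≤ M := by
  calc ∫ ω, |f ω * g ω| ∂P ≤ ∫ ω, (f ω ^ 2 + g ω ^ 2) / 2 ∂P :=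
        integral_mono (hf.integrable_mul hg).abs ((hf.integrable_sq.add hg.integrable_sq).div_const 2)
          fun ω => abs_mul_le_half_sq_add_sq _ _
    _ = (∫ ω, f ω ^ 2 ∂P + ∫ ω, g ω ^ 2 ∂P) / 2 := by
        rw [integral_div, integral_add hf.integrable_sq hg.integrable_sq]
    _ ≤ M := by linarith

theorem integrable_prod_path_sq (hX : Measurable fun q : Ω × Z => X q.1 q.2)
    (hX2 : ∀ x, MemLp (fun ω => X ω x) 2 P) (hM : ∀ x, ∫ ω, X ω x ^ 2 ∂P ≤ M) :
    Integrable (fun q : Ω × Z => X q.1 q.2 ^ 2) (P.prod μ) := by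
  rw [integrable_prod_iff' (hX.pow_const 2).aestronglyMeasurable]
  refine ⟨.of_forall fun x => (hX2 x).integrable_sq, ?_⟩
  refine Integrable.of_bound (C := M)
    (hX.pow_const 2).stronglyMeasurable.norm.integral_prod_left'.aestronglyMeasurable
    (.of_forall fun x => ?_)
  simp only [Real.norm_eq_abs, abs_pow, sq_abs]
  rw [abs_of_nonneg (integral_nonneg fun ω => sq_nonneg _)]
  exact hM x

theorem ae_memLp_path (hX : Measurable fun q : Ω × Z => X q.1 q.2)
    (hX2 : ∀ x, MemLp (fun ω => X ω x) 2 P) (hM : ∀ x, ∫ ω, X ω x ^ 2 ∂P ≤ M) :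
    ∀ᵐ ω ∂P, MemLp (X ω) 2 μ := by
  filter_upwards [(integrable_prod_path_sq (μ := μ) hX hX2 hM).prod_right_ae] with ω hω
  exact (memLp_two_iff_integrable_sq (hX.of_uncurry_left).aestronglyMeasurable).2 hω

/-- Integrating over ω before the points bounds the absolute value by M |g(x)| |h(x')|. This
licenses Fubini for products of two path integrals. -/
theorem integrable_prod_mul_paths (hX : Measurable fun q : Ω × Z => X q.1 q.2)
    (hX2 : ∀ x, MemLp (fun ω => X ω x) 2 P) (hM : ∀ x, ∫ ω, X ω x ^ 2 ∂P ≤ M)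
    {g h : Z → ℝ} (hg : Integrable g μ) (hh : Integrable h μ) :
    Integrable (fun q : Ω × Z × Z => X q.1 q.2.1 * g q.2.1 * (X q.1 q.2.2 * h q.2.2))
      (P.prod (μ.prod μ)) := by
  have hm : AEStronglyMeasurable
      (fun q : Ω × Z × Z => X q.1 q.2.1 * g q.2.1 * (X q.1 q.2.2 * h q.2.2))
      (P.prod (μ.prod μ)) := by
    have h1 : Measurable fun q : Ω × Z × Z => X q.1 q.2.1 :=
      hX.comp (measurable_fst.prodMk (measurable_fst.comp measurable_snd))
    have h2 : Measurable fun q : Ω × Z × Z => X q.1 q.2.2 :=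
      hX.comp (measurable_fst.prodMk (measurable_snd.comp measurable_snd))
    have h3 : AEStronglyMeasurable (fun q : Ω × Z × Z => g q.2.1) (P.prod (μ.prod μ)) :=
      AEStronglyMeasurable.comp_snd (f := fun q : Z × Z => g q.1) hg.aestronglyMeasurable.comp_fst
    have h4 : AEStronglyMeasurable (fun q : Ω × Z × Z => h q.2.2) (P.prod (μ.prod μ)) :=
      AEStronglyMeasurable.comp_snd (f := fun q : Z × Z => h q.2) hh.aestronglyMeasurable.comp_snd
    exact (h1.aestronglyMeasurable.mul h3).mul (h2.aestronglyMeasurable.mul h4)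
  rw [integrable_prod_iff' hm]
  refine ⟨.of_forall fun q => ?_, ?_⟩
  · convert (((hX2 q.1).integrable_mul (hX2 q.2)).mul_const (g q.1 * h q.2)) using 2
    simp only [Pi.mul_apply]
    ring
  · refine Integrable.mono' ((hg.mul_prod hh).norm.const_mul M)
      (hm.norm.prod_swap.integral_prod_right') (.of_forall fun q => ?_)
    have : (fun ω => ‖X ω q.1 * g q.1 * (X ω q.2 * h q.2)‖)
        = fun ω => |X ω q.1 * X ω q.2| * ‖g q.1 * h q.2‖ := by
      ext ω
      simp only [Real.norm_eq_abs, abs_mul]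
      ring
    simp only [this, integral_mul_const]
    rw [norm_mul, norm_norm, Real.norm_of_nonneg (integral_nonneg fun ω => abs_nonneg _)]
    gcongr
    exact integral_abs_mul_le_of_sq_le (hX2 _) (hX2 _) (hM _) (hM _)

theorem integrable_mul_path_integrals (hX : Measurable fun q : Ω × Z => X q.1 q.2)
    (hX2 : ∀ x, MemLp (fun ω => X ω x) 2 P) (hM : ∀ x, ∫ ω, X ω x ^ 2 ∂P ≤ M)
    {g h : Z → ℝ} (hg : Integrable g μ) (hh : Integrable h μ) :
    Integrable (fun ω => (∫ x, X ω x * g x ∂μ) * ∫ x, X ω x * h x ∂μ) P := by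
  refine (integrable_prod_mul_paths hX hX2 hM hg hh).integral_prod_left.congr
    (.of_forall fun ω => ?_)
  exact integral_prod_mul (fun x => X ω x * g x) fun x => X ω x * h x

theorem integral_mul_path_integrals (hX : Measurable fun q : Ω × Z => X q.1 q.2)
    (hX2 : ∀ x, MemLp (fun ω => X ω x) 2 P) (hM : ∀ x, ∫ ω, X ω x ^ 2 ∂P ≤ M)
    {g h : Z → ℝ} (hg : Integrable g μ) (hh : Integrable h μ) :
    ∫ ω, (∫ x, X ω x * g x ∂μ) * ∫ x, X ω x * h x ∂μ ∂P
      = ∫ q : Z × Z, ∫ ω, X ω q.1 * g q.1 * (X ω q.2 * h q.2) ∂P ∂(μ.prod μ) := by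
  have h1 : ∀ ω, (∫ x, X ω x * g x ∂μ) * ∫ x, X ω x * h x ∂μ
      = ∫ q : Z × Z, X ω q.1 * g q.1 * (X ω q.2 * h q.2) ∂(μ.prod μ) := fun ω =>
    (integral_prod_mul (fun x => X ω x * g x) fun x => X ω x * h x).symm
  simp_rw [h1]
  exact integral_integral_swap (f := fun ω (q : Z × Z) => X ω q.1 * g q.1 * (X ω q.2 * h q.2))
    (integrable_prod_mul_paths hX hX2 hM hg hh)

theorem measurable_path_integral (hX : Measurable fun q : Ω × Z => X q.1 q.2) {g : Z → ℝ}
    (hg : Measurable g) : Measurable fun ω => ∫ x, X ω x * g x ∂μ :=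
  (StronglyMeasurable.integral_prod_right (f := fun ω x => X ω x * g x)
    (hX.mul (hg.comp measurable_snd)).stronglyMeasurable).measurable

theorem integrable_prod_path_mul (hX : Measurable fun q : Ω × Z => X q.1 q.2)
    (hX2 : ∀ x, MemLp (fun ω => X ω x) 2 P) (hM : ∀ x, ∫ ω, X ω x ^ 2 ∂P ≤ M)
    {g : Z → ℝ} (hg : MemLp g 2 μ) :
    Integrable (fun q : Ω × Z => X q.1 q.2 * g q.2) (P.prod μ) := by
  have h1 : MemLp (fun q : Ω × Z => X q.1 q.2) 2 (P.prod μ) :=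
    (memLp_two_iff_integrable_sq hX.aestronglyMeasurable).2 (integrable_prod_path_sq hX hX2 hM)
  have h2 : MemLp (fun q : Ω × Z => g q.2) 2 (P.prod μ) := hg.comp_snd P
  exact h1.integrable_mul h2

/-- Riemann sums for `∫ X ω x * g x ∂μ` on the fibres of a simple function `q`. -/
def riemannSum (μ : Measure Z) (g : Z → ℝ) (q : SimpleFunc Z Z) (v : Z → ℝ) : ℝ :=
  ∑ c ∈ q.range, v c * ∫ x in q ⁻¹' {c}, g x ∂μ

/-- The left side reads only finitely many values of `v`, so it is measurable for the product
σ-algebra on paths. -/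
theorem riemannSum_eq {g : Z → ℝ} (hg : Integrable g μ) (q : SimpleFunc Z Z) (v : Z → ℝ) :
    riemannSum μ g q v = ∫ x, v (q x) * g x ∂μ := by
  have h : ∀ x, v (q x) * g x = ∑ c ∈ q.range, (q ⁻¹' {c}).indicator (fun x => v c * g x) x := by
    intro x
    rw [Finset.sum_eq_single (q x)]
    · simp
    · intro c _ hc
      simp [Set.indicator, hc.symm]
    · intro hx
      exact absurd (q.mem_range_self x) hx
  simp_rw [h]
  rw [integral_finsetSum _ fun c _ => (hg.const_mul _).indicator (q.measurableSet_fiber c)]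
  refine Finset.sum_congr rfl fun c _ => ?_
  rw [integral_indicator (q.measurableSet_fiber c), integral_const_mul]

end SecondOrder

/-! ### Path integrals as measurable functions of the path. -/

section PathIntegral

variable {Ω Z : Type*} [MeasurableSpace Ω] {P : Measure Ω} [IsProbabilityMeasure P]
  [MetricSpace Z] [CompactSpace Z] [MeasurableSpace Z] [BorelSpace Z]
  {μ : Measure Z} [IsProbabilityMeasure μ] {X : Ω → Z → ℝ} {M : ℝ}

theorem integral_abs_le_sqrt_integral_sq {f : Ω → ℝ} (hf : MemLp f 2 P) :
    ∫ ω, |f ω| ∂P ≤ √(∫ ω, f ω ^ 2 ∂P) := by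
  apply Real.le_sqrt_of_sq_le
  have h := variance_nonneg (fun ω => |f ω|) P
  rw [variance_eq_sub (X := fun ω => |f ω|) hf.abs] at h
  simpa using h

/-- The integral of a mean-square continuous process against a square integrable function is
almost surely a measurable function of the path, for the product `σ`-algebra on paths. -/
theorem exists_measurable_path_integral (hX : Measurable fun q : Ω × Z => X q.1 q.2)
    (hX2 : ∀ x, MemLp (fun ω => X ω x) 2 P) (hM : ∀ x, ∫ ω, X ω x ^ 2 ∂P ≤ M)
    (hc : ∀ x, Tendsto (fun x' => ∫ ω, |X ω x - X ω x'| ^ 2 ∂P) (𝓝 x) (𝓝 0))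
    {g : Z → ℝ} (hgm : Measurable g) (hg : MemLp g 2 μ) :
    ∃ G : (Z → ℝ) → ℝ, Measurable G ∧ ∀ᵐ ω ∂P, ∫ x, X ω x * g x ∂μ = G (X ω) := by
  -- A compact metric space is second countable, so the identity is a pointwise limit of simple
  -- functions `q m`, which supply the nodes of the Riemann sums.
  have hid : StronglyMeasurable (id : Z → Z) := measurable_id.stronglyMeasurable
  set q := hid.approx
  have hq : ∀ x, Tendsto (fun m => q m x) atTop (𝓝 x) := hid.tendsto_approx
  have hgi : Integrable g μ := hg.integrable one_le_two
  have hmeas : ∀ m, Measurable fun v : Z → ℝ => riemannSum μ g (q m) v := fun m =>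
    Finset.measurable_sum _ fun c _ => (measurable_pi_apply c).mul_const _
  have hXm : ∀ m, Measurable fun r : Ω × Z => X r.1 (q m r.2) := fun m =>
    hX.comp (measurable_fst.prodMk ((q m).measurable.comp measurable_snd))
  have hI := integrable_prod_path_mul hX hX2 hM hg
  have hIm : ∀ m, Integrable (fun r : Ω × Z => X r.1 (q m r.2) * g r.2) (P.prod μ) := fun m =>
    integrable_prod_path_mul (X := fun ω x => X ω (q m x)) (hXm m) (fun x => hX2 _)
      (fun x => hM _) hg
  have hd : ∀ m x, MemLp (fun ω => X ω x - X ω (q m x)) 2 P := fun m x => (hX2 _).sub (hX2 _)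
  -- the expected absolute error
  have hL1 : Tendsto (fun m => ∫ x, (∫ ω, |X ω x - X ω (q m x)| ∂P) * |g x| ∂μ) atTop (𝓝 0) := by
    have hM0 : ∀ x, ∫ ω, |X ω x| ∂P ≤ √M := fun x =>
      (integral_abs_le_sqrt_integral_sq (hX2 x)).trans (Real.sqrt_le_sqrt (hM x))
    rw [← integral_zero Z ℝ (μ := μ)]
    refine tendsto_integral_of_dominated_convergence (fun x => 2 * √M * |g x|) (fun m => ?_)
      (hgi.abs.const_mul _) (fun m => .of_forall fun x => ?_) (.of_forall fun x => ?_)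
    · refine ((StronglyMeasurable.integral_prod_left'
        (f := fun r : Ω × Z => |X r.1 r.2 - X r.1 (q m r.2)|) ?_).mul
          hgm.abs.stronglyMeasurable).aestronglyMeasurable
      exact (hX.sub (hXm m)).abs.stronglyMeasurable
    · rw [norm_mul, Real.norm_of_nonneg (integral_nonneg fun ω => abs_nonneg _), norm_abs_eq_norm,
        Real.norm_eq_abs]
      gcongr
      have i1 : ∀ x, Integrable (fun ω => |X ω x|) P := fun x => ((hX2 x).integrable one_le_two).abs
      calc ∫ ω, |X ω x - X ω (q m x)| ∂P ≤ ∫ ω, (|X ω x| + |X ω (q m x)|) ∂P :=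
            integral_mono ((hd m x).integrable one_le_two).abs ((i1 _).add (i1 _))
              fun ω => abs_sub _ _
        _ = ∫ ω, |X ω x| ∂P + ∫ ω, |X ω (q m x)| ∂P := integral_add (i1 _) (i1 _)
        _ ≤ 2 * √M := by linarith [hM0 x, hM0 (q m x)]
    -- Mean-square continuity enters here: the node `q m x` tends to `x`, and the first absolute
    -- moment is at most the root of the second.
    · have h0 : Tendsto (fun m => √(∫ ω, |X ω x - X ω (q m x)| ^ 2 ∂P)) atTop (𝓝 0) := by
        have := ((hc x).comp (hq x)).sqrt
        simpa using this
      have h1 : Tendsto (fun m => ∫ ω, |X ω x - X ω (q m x)| ∂P) atTop (𝓝 0) := by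
        refine squeeze_zero (fun m => integral_nonneg fun ω => abs_nonneg _) (fun m => ?_) h0
        have := integral_abs_le_sqrt_integral_sq (hd m x)
        simpa only [sq_abs] using this
      simpa using h1.mul_const |g x|
  have hle : ∀ m, eLpNorm ((fun ω => riemannSum μ g (q m) (X ω)) - fun ω => ∫ x, X ω x * g x ∂μ) 1 P
      ≤ ENNReal.ofReal (∫ x, (∫ ω, |X ω x - X ω (q m x)| ∂P) * |g x| ∂μ) := by
    intro m
    have hint : Integrable (fun r : Ω × Z => |X r.1 r.2 * g r.2 - X r.1 (q m r.2) * g r.2|)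
        (P.prod μ) := (hI.sub (hIm m)).abs
    have hdiff : Integrable ((fun ω => riemannSum μ g (q m) (X ω)) - fun ω => ∫ x, X ω x * g x ∂μ)
        P := by
      refine Integrable.sub ?_ hI.integral_prod_left
      simp_rw [riemannSum_eq hgi]
      exact (hIm m).integral_prod_left
    rw [eLpNorm_one_eq_lintegral_enorm, ← ofReal_integral_norm_eq_lintegral_enorm hdiff]
    apply ENNReal.ofReal_le_ofReal
    calc ∫ ω, ‖((fun ω => riemannSum μ g (q m) (X ω)) - fun ω => ∫ x, X ω x * g x ∂μ) ω‖ ∂P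
        ≤ ∫ ω, ∫ x, |X ω x * g x - X ω (q m x) * g x| ∂μ ∂P := by
          refine integral_mono_ae hdiff.norm hint.integral_prod_left ?_
          filter_upwards [hI.prod_right_ae, (hIm m).prod_right_ae] with ω h1 h2
          simp only [Pi.sub_apply]
          rw [riemannSum_eq hgi, ← integral_sub h2 h1]
          refine (norm_integral_le_integral_norm _).trans (le_of_eq ?_)
          refine integral_congr_ae (.of_forall fun x => ?_)
          simp only [Real.norm_eq_abs]
          rw [abs_sub_comm]
      _ = ∫ x, ∫ ω, |X ω x * g x - X ω (q m x) * g x| ∂P ∂μ :=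
          integral_integral_swap (f := fun ω x => |X ω x * g x - X ω (q m x) * g x|) hint
      _ = _ := by
          refine integral_congr_ae (.of_forall fun x => ?_)
          simp only
          rw [← integral_mul_const]
          refine integral_congr_ae (.of_forall fun ω => ?_)
          simp only
          rw [← sub_mul, abs_mul]
  have hmeasure : TendstoInMeasure P (fun m ω => riemannSum μ g (q m) (X ω)) atTop
      fun ω => ∫ x, X ω x * g x ∂μ := by
    have hXp : Measurable fun ω => X ω := measurable_pi_lambda _ fun x => hX.of_uncurry_right
    refine tendstoInMeasure_of_tendsto_eLpNorm one_ne_zero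
      (fun m => ((hmeas m).comp hXp).aestronglyMeasurable)
      (measurable_path_integral hX hgm).aestronglyMeasurable ?_
    refine tendsto_of_tendsto_of_tendsto_of_le_of_le tendsto_const_nhds ?_ (fun _ => zero_le) hle
    simpa using (ENNReal.tendsto_ofReal hL1)
  -- Convergence in L¹ gives almost sure convergence along a subsequence; taking a limsup keeps the
  -- limit measurable on all paths.
  obtain ⟨ns, -, hns⟩ := hmeasure.exists_seq_tendsto_ae
  refine ⟨fun v => limsup (fun i => riemannSum μ g (q (ns i)) v) atTop,
    Measurable.limsup fun i => hmeas _, ?_⟩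
  filter_upwards [hns] with ω hω
  exact hω.limsup_eq.symm

end PathIntegral

/-! ### Parseval's identity and projections on the eigenfunctions. -/

section Eigenfunctions

/-- Measurable square integrable eigenfunctions `e k` for the eigenvalues `lam k`, orthonormal
where `lam k > 0`, complete, and `0` where `lam k = 0`. -/
structure IsEigenbasis {Z : Type*} [MeasurableSpace Z] (μ : Measure Z) (f : Z → Z → ℝ)
    (lam : ℕ → ℝ) (e : ℕ → Z → ℝ) : Prop where
  nonneg : ∀ k, 0 ≤ lam k
  measurable : ∀ k, Measurable (e k)
  memLp : ∀ k, MemLp (e k) 2 μ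
  orthonormal : ∀ k l, ∫ x, e k x * e l x ∂μ = if k = l ∧ 0 < lam k then 1 else 0
  eq_zero : ∀ k, lam k = 0 → e k = 0
  eigen : ∀ k x, ∫ x', f x x' * e k x' ∂μ = lam k * e k x
  complete : ∀ h : Z → ℝ, MemLp h 2 μ → (∀ k, ∫ x, h x * e k x ∂μ = 0) →
    ∀ᵐ x ∂μ, ∫ x', f x x' * h x' ∂μ = 0

variable {Z : Type*} [MeasurableSpace Z] {μ : Measure Z} {f : Z → Z → ℝ} {lam : ℕ → ℝ}
  {e : ℕ → Z → ℝ}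

theorem inner_toLp_toLp {g h : Z → ℝ} (hg : MemLp g 2 μ) (hh : MemLp h 2 μ) :
    inner ℝ (hg.toLp g) (hh.toLp h) = ∫ x, g x * h x ∂μ := by
  rw [L2.inner_def]
  refine integral_congr_ae ?_
  filter_upwards [hg.coeFn_toLp, hh.coeFn_toLp] with x h1 h2
  rw [h1, h2]
  simp [mul_comm]

theorem inner_toLp_right {g : Z → ℝ} (hg : MemLp g 2 μ) (h : Lp ℝ 2 μ) :
    inner ℝ (hg.toLp g) h = ∫ x, g x * h x ∂μ := by
  rw [L2.inner_def]
  refine integral_congr_ae ?_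
  filter_upwards [hg.coeFn_toLp] with x h1
  rw [h1]
  simp [mul_comm]

/-- Distinct orthonormal vectors are √2 apart, so they form a discrete subset of a second countable
space. -/
theorem _root_.Orthonormal.countable_of_separableSpace {H ι : Type*} [NormedAddCommGroup H]
    [InnerProductSpace ℝ H] [SecondCountableTopology H] {v : ι → H} (hv : Orthonormal ℝ v) :
    Countable ι := by
  have hd : ∀ i j, i ≠ j → 1 ≤ dist (v i) (v j) := by
    intro i j hij
    rw [dist_eq_norm]
    have h : ‖v i - v j‖ ^ 2 = 2 := by
      rw [norm_sub_sq_real, hv.1 i, hv.1 j, hv.2 hij]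
      norm_num
    nlinarith [norm_nonneg (v i - v j)]
  have hinj : Function.Injective v := fun i j hij => by
    by_contra hne
    have := hd i j hne
    rw [hij, dist_self] at this
    linarith
  have hdisc : DiscreteTopology (Set.range v) := by
    refine DiscreteTopology.of_forall_le_dist one_pos ?_
    rintro ⟨_, i, rfl⟩ ⟨_, j, rfl⟩ hne
    exact hd i j fun h => hne (by simp [h])
  have hc : Countable (Set.range v) :=
    TopologicalSpace.separableSpace_iff_countable.1 inferInstance
  exact Function.Injective.countable (f := fun i => (⟨v i, i, rfl⟩ : Set.range v))
    fun i j h => hinj (congrArg Subtype.val h)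

/-- Parseval's identity for functions orthogonal to a countable set complementing the
eigenfunctions. -/
theorem IsEigenbasis.exists_countable_parseval [SecondCountableTopology (Lp ℝ 2 μ)]
    (he : IsEigenbasis μ f lam e) :
    ∃ S : Set (Lp ℝ 2 μ), S.Countable ∧ (∀ h ∈ S, ∀ k, ∫ x, h x * e k x ∂μ = 0) ∧
      ∀ g : Z → ℝ, MemLp g 2 μ → (∀ h ∈ S, ∫ x, g x * h x ∂μ = 0) →
        HasSum (fun k => (∫ x, g x * e k x ∂μ) ^ 2) (∫ x, g x ^ 2 ∂μ) := by
  set v : {k // 0 < lam k} → Lp ℝ 2 μ := fun k => (he.memLp k).toLp (e k) with hv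
  have hvo : Orthonormal ℝ v := by
    rw [orthonormal_iff_ite]
    rintro ⟨k, hk⟩ ⟨l, hl⟩
    simp only [hv, inner_toLp_toLp, he.orthonormal, Subtype.mk.injEq, hk, and_true]
  obtain ⟨w, b, hw, hb⟩ := hvo.toSubtypeRange.exists_hilbertBasis_extension
  have hwo : Orthonormal ℝ ((↑) : w → Lp ℝ 2 μ) := hb ▸ b.orthonormal
  have hwc : w.Countable := Set.countable_coe_iff.1 hwo.countable_of_separableSpace
  -- The eigenfunctions with positive eigenvalue extend to a Hilbert basis `w`; S consists of the
  -- added vectors, and a `g` orthogonal to them has no other coefficients.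
  refine ⟨w \ Set.range v, hwc.mono Set.sdiff_subset, ?_, ?_⟩
  · rintro h ⟨hhw, hhv⟩ k
    rcases (he.nonneg k).eq_or_lt with hk | hk
    · simp [he.eq_zero k hk.symm]
    · have := hwo.2 (i := ⟨v ⟨k, hk⟩, hw ⟨_, rfl⟩⟩) (j := ⟨h, hhw⟩) fun hc =>
        hhv ⟨⟨k, hk⟩, congrArg Subtype.val hc⟩
      simp only [hv, inner_toLp_right] at this
      simpa only [mul_comm] using this
  · intro g hg hgS
    have hsum := b.hasSum_inner_mul_inner (hg.toLp g) (hg.toLp g)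
    rw [inner_toLp_toLp] at hsum
    let φ : {k // 0 < lam k} → w := fun k => ⟨v k, hw ⟨k, rfl⟩⟩
    have hφ : Function.Injective φ := fun k l hkl =>
      hvo.linearIndependent.injective (congrArg Subtype.val hkl)
    rw [← hφ.hasSum_iff] at hsum
    · have hφsum : HasSum ((fun k => (∫ x, g x * e k x ∂μ) ^ 2) ∘ ((↑) : {k // 0 < lam k} → ℕ))
          (∫ x, g x * g x ∂μ) := by
        have hfun : (fun k => (∫ x, g x * e k x ∂μ) ^ 2) ∘ ((↑) : {k // 0 < lam k} → ℕ)
            = (fun i => inner ℝ (hg.toLp g) (b i) * inner ℝ (b i) (hg.toLp g)) ∘ φ := by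
          funext k
          have h1 : b (φ k) = v k := by rw [hb]
          simp only [Function.comp_apply, h1]
          rw [real_inner_comm (hg.toLp g), ← sq]
          simp only [hv]
          rw [inner_toLp_toLp]
        rw [hfun]
        exact hsum
      rw [Subtype.val_injective.hasSum_iff] at hφsum
      · simpa only [sq] using hφsum
      · intro k hk
        have : lam k = 0 := by
          by_contra hne
          exact hk ⟨⟨k, (he.nonneg k).lt_of_ne' hne⟩, rfl⟩
        simp [he.eq_zero k this]
    · intro h hh
      have h0 : inner ℝ (hg.toLp g) (b h) = 0 := by
        rw [hb, inner_toLp_right]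
        exact hgS _ ⟨h.2, fun ⟨k, hk⟩ => hh ⟨k, Subtype.ext hk⟩⟩
      rw [h0, zero_mul]

/-- The orthogonal projection of `g` on the first `N` eigenfunctions. -/
def partialSum (μ : Measure Z) (e : ℕ → Z → ℝ) (g : Z → ℝ) (N : ℕ) (x : Z) : ℝ :=
  ∑ k ∈ Finset.range N, (∫ y, g y * e k y ∂μ) * e k x

theorem IsEigenbasis.memLp_partialSum (he : IsEigenbasis μ f lam e) (g : Z → ℝ) (N : ℕ) :
    MemLp (partialSum μ e g N) 2 μ :=
  memLp_finsetSum _ fun k _ => (he.memLp k).const_mul _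

theorem IsEigenbasis.integral_sub_partialSum_mul (he : IsEigenbasis μ f lam e) {g : Z → ℝ}
    (hg : MemLp g 2 μ) (N : ℕ) :
    ∫ x, (g x - partialSum μ e g N x) * e N x ∂μ = ∫ x, g x * e N x ∂μ := by
  have h1 : ∫ x, partialSum μ e g N x * e N x ∂μ = 0 := by
    simp_rw [partialSum, Finset.sum_mul, mul_assoc]
    rw [integral_finsetSum _ fun k _ =>
      Integrable.const_mul (f := fun x => e k x * e N x) ((he.memLp k).integrable_mul (he.memLp N)) _]
    refine Finset.sum_eq_zero fun k hk => ?_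
    have hkN : k ≠ N := (Finset.mem_range.1 hk).ne
    rw [integral_const_mul, he.orthonormal]
    simp [hkN]
  simp_rw [sub_mul]
  have h2 := integral_sub (hg.integrable_mul (he.memLp N))
    ((he.memLp_partialSum g N).integrable_mul (he.memLp N))
  simp only [Pi.mul_apply] at h2
  rw [h2, h1, sub_zero]

/-- Pythagoras, one eigenfunction at a time: the residual has the same coefficient on `e N` as `g`,
so each step removes its square. -/
theorem IsEigenbasis.integral_sub_partialSum_sq (he : IsEigenbasis μ f lam e) {g : Z → ℝ}
    (hg : MemLp g 2 μ) (N : ℕ) :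
    ∫ x, (g x - partialSum μ e g N x) ^ 2 ∂μ
      = ∫ x, g x ^ 2 ∂μ - ∑ k ∈ Finset.range N, (∫ x, g x * e k x ∂μ) ^ 2 := by
  induction N with
  | zero => simp [partialSum]
  | succ N ih =>
    set c := ∫ x, g x * e N x ∂μ with hc
    have hr : MemLp (fun x => g x - partialSum μ e g N x) 2 μ := hg.sub (he.memLp_partialSum g N)
    have h1 : ∀ x, (g x - partialSum μ e g (N + 1) x) ^ 2
        = (g x - partialSum μ e g N x) ^ 2
          - (2 * c) * ((g x - partialSum μ e g N x) * e N x) + c ^ 2 * (e N x * e N x) := by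
      intro x
      simp only [partialSum, Finset.sum_range_succ, ← hc]
      ring
    have i1 : Integrable (fun x => (2 * c) * ((g x - partialSum μ e g N x) * e N x)) μ :=
      (hr.integrable_mul (he.memLp N)).const_mul _
    have i2 : Integrable (fun x => c ^ 2 * (e N x * e N x)) μ :=
      ((he.memLp N).integrable_mul (he.memLp N)).const_mul _
    have h3 : c ^ 2 * ∫ x, e N x * e N x ∂μ = c ^ 2 := by
      rcases (he.nonneg N).eq_or_lt with h | h
      · have : c = 0 := by simp [hc, he.eq_zero N h.symm]
        simp [this]
      · simp [he.orthonormal, h]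
    simp_rw [h1]
    rw [integral_add (f := fun x => (g x - partialSum μ e g N x) ^ 2
        - 2 * c * ((g x - partialSum μ e g N x) * e N x)) (hr.integrable_sq.sub i1) i2, integral_sub hr.integrable_sq i1,
      integral_const_mul, integral_const_mul, he.integral_sub_partialSum_mul hg, ih, h3,
      Finset.sum_range_succ]
    ring

end Eigenfunctions

/-! ### Summable mean square errors from the eigenvalue decay. -/

section Expansion

/-- The term `a m` occurs once for each N ≤ m, hence m + 1 times. This is the source of the weight k
+ 1 in the decay condition. -/
theorem ENNReal_tsum_tsum_add (a : ℕ → ℝ≥0∞) :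
    ∑' N, ∑' k, a (k + N) = ∑' m : ℕ, ((m : ℝ≥0∞) + 1) * a m := by
  rw [← ENNReal.tsum_prod (f := fun N k => a (k + N)),
    ← Finset.HasAntidiagonal.sigmaAntidiagonalEquivProd.tsum_eq, ENNReal.tsum_sigma']
  refine tsum_congr fun m => ?_
  rw [tsum_fintype]
  have (q : (Finset.HasAntidiagonal.antidiagonal m : Finset (ℕ × ℕ))) :
      a ((Finset.HasAntidiagonal.sigmaAntidiagonalEquivProd ⟨m, q⟩).2
        + (Finset.HasAntidiagonal.sigmaAntidiagonalEquivProd ⟨m, q⟩).1) = a m := by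
    obtain ⟨q, hq⟩ := q
    rw [Finset.HasAntidiagonal.mem_antidiagonal] at hq
    simp [Finset.HasAntidiagonal.sigmaAntidiagonalEquivProd, ← hq, add_comm]
  rw [Finset.sum_congr rfl fun q _ => this q]
  simp

variable {Ω Z : Type*} [MeasurableSpace Ω] [MeasurableSpace Z] {P : Measure Ω}
  [IsProbabilityMeasure P] {μ : Measure Z} [IsProbabilityMeasure μ]
  {f : Z → Z → ℝ} {lam : ℕ → ℝ} {e : ℕ → Z → ℝ}

theorem IsEigenbasis.measurable_partialSum (he : IsEigenbasis μ f lam e) {X : Ω → Z → ℝ}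
    (hX : Measurable fun q : Ω × Z => X q.1 q.2) (N : ℕ) :
    Measurable fun q : Ω × Z => partialSum μ e (X q.1) N q.2 :=
  Finset.measurable_sum _ fun k _ =>
    ((measurable_path_integral hX (he.measurable k)).comp measurable_fst).mul
      ((he.measurable k).comp measurable_snd)

/-- If `𝔼|⟨X, e k⟩|² ≤ C lam k` with `∑ (k + 1) lam k < ∞`, the expansion of the paths in the
eigenfunctions converges at almost every point, with summable mean square errors. -/
theorem IsEigenbasis.ae_tsum_lintegral_sub_partialSum (he : IsEigenbasis μ f lam e)
    {X : Ω → Z → ℝ} {M C : ℝ} (hX : Measurable fun q : Ω × Z => X q.1 q.2)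
    (hX2 : ∀ x, MemLp (fun ω => X ω x) 2 P) (hM : ∀ x, ∫ ω, X ω x ^ 2 ∂P ≤ M)
    (hsum : ∀ᵐ ω ∂P, HasSum (fun k => (∫ x, X ω x * e k x ∂μ) ^ 2) (∫ x, X ω x ^ 2 ∂μ))
    (hC : ∀ k, ∫ ω, (∫ x, X ω x * e k x ∂μ) ^ 2 ∂P ≤ C * lam k)
    (hdecay : Summable fun k : ℕ => ((k : ℝ) + 1) * lam k) :
    ∀ᵐ x ∂μ, ∑' N, ∫⁻ ω, ENNReal.ofReal ((X ω x - partialSum μ e (X ω) N x) ^ 2) ∂P ≠ ∞ := by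
  have hS := he.measurable_partialSum hX
  have hm : ∀ N, Measurable fun q : Ω × Z =>
      ENNReal.ofReal ((X q.1 q.2 - partialSum μ e (X q.1) N q.2) ^ 2) := fun N =>
    ((hX.sub (hS N)).pow_const 2).ennreal_ofReal
  have hcm : ∀ k, Measurable fun ω => ∫ x, X ω x * e k x ∂μ := fun k =>
    measurable_path_integral hX (he.measurable k)
  have hci : ∀ k, Integrable (fun ω => (∫ x, X ω x * e k x ∂μ) ^ 2) P := fun k => by
    have hek : Integrable (e k) μ := (he.memLp k).integrable one_le_two
    simpa only [sq] using integrable_mul_path_integrals hX hX2 hM hek hek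
  -- After swapping the integrals, Parseval turns the error of each path into the tail of its
  -- squared coefficients.
  have hN : ∀ N, ∫⁻ x, ∫⁻ ω, ENNReal.ofReal ((X ω x - partialSum μ e (X ω) N x) ^ 2) ∂P ∂μ
      = ∑' k, ∫⁻ ω, ENNReal.ofReal ((∫ x, X ω x * e (k + N) x ∂μ) ^ 2) ∂P := by
    intro N
    rw [lintegral_lintegral_swap
        (f := fun x ω => ENNReal.ofReal ((X ω x - partialSum μ e (X ω) N x) ^ 2))
        ((hm N).comp measurable_swap).aemeasurable,
      ← lintegral_tsum fun k => ((hcm _).pow_const 2).ennreal_ofReal.aemeasurable]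
    refine lintegral_congr_ae ?_
    filter_upwards [hsum, ae_memLp_path (μ := μ) hX hX2 hM] with ω h1 h2
    rw [← ofReal_integral_eq_lintegral_ofReal (f := fun x => (X ω x - partialSum μ e (X ω) N x) ^ 2)
      (h2.sub (he.memLp_partialSum _ N)).integrable_sq
      (.of_forall fun x => sq_nonneg _), ← ENNReal.ofReal_tsum_of_nonneg (fun k => sq_nonneg _)
        ((summable_nat_add_iff N).2 h1.summable)]
    congr 1
    rw [he.integral_sub_partialSum_sq h2, ← h1.tsum_eq, ← h1.summable.sum_add_tsum_nat_add N]
    ring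
  have htotal : ∫⁻ x, ∑' N, ∫⁻ ω, ENNReal.ofReal ((X ω x - partialSum μ e (X ω) N x) ^ 2) ∂P ∂μ
      ≠ ∞ := by
    rw [lintegral_tsum fun N => (hm N).lintegral_prod_left'.aemeasurable]
    simp_rw [hN]
    rw [ENNReal_tsum_tsum_add
      fun k => ∫⁻ ω, ENNReal.ofReal ((∫ x, X ω x * e k x ∂μ) ^ 2) ∂P]
    refine ne_top_of_le_ne_top (hdecay.mul_left C).tsum_ofReal_ne_top
      (ENNReal.tsum_le_tsum fun k => ?_)
    rw [← ofReal_integral_eq_lintegral_ofReal (hci k) (.of_forall fun ω => sq_nonneg _),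
      ← ENNReal.ofReal_natCast, ← ENNReal.ofReal_one,
      ← ENNReal.ofReal_add (Nat.cast_nonneg k) zero_le_one,
      ← ENNReal.ofReal_mul (by positivity)]
    apply ENNReal.ofReal_le_ofReal
    nlinarith [hC k, (Nat.cast_nonneg k : (0 : ℝ) ≤ k)]
  filter_upwards [ae_lt_top (Measurable.tsum fun N => (hm N).lintegral_prod_left') htotal]
    with x hx using hx.ne

end Expansion

/-! ### Eigenfunction expansion of the random functions and of the kernel. -/

section RandomFunctions

/-- Jointly measurable random functions with uniformly bounded second moments. -/
structure IsBoundedProcess {Ω Z : Type*} [MeasurableSpace Ω] [MeasurableSpace Z] {p : ℕ}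
    (P : Measure Ω) (ψ : Fin p → Ω → Z → ℝ) (M : ℝ) : Prop where
  measurable : ∀ j, Measurable fun q : Ω × Z => ψ j q.1 q.2
  memLp : ∀ j x, MemLp (fun ω => ψ j ω x) 2 P
  integral_sq_le : ∀ j x, ∫ ω, ψ j ω x ^ 2 ∂P ≤ M

variable {Ω Z : Type*} [MeasurableSpace Ω] [MeasurableSpace Z] {P : Measure Ω}
  [IsProbabilityMeasure P] {μ : Measure Z} [IsProbabilityMeasure μ] {p : ℕ}
  {ψ : Fin p → Ω → Z → ℝ} {M : ℝ}

theorem pow_two_le_one_add_pow_four (t : ℝ) : t ^ 2 ≤ 1 + t ^ 4 := by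
  nlinarith [sq_nonneg (t ^ 2 - 1), sq_nonneg t, sq_nonneg (t ^ 2)]

theorem integrable_pow_four_of_memLp {g : Ω → ℝ} (hg : MemLp g 4 P) :
    Integrable (fun ω => g ω ^ 4) P := by
  have h := hg.integrable_norm_pow (p := 4) (by norm_num)
  have h4 : Even 4 := by decide
  simpa only [Real.norm_eq_abs, h4.pow_abs] using h

theorem memLp_two_of_memLp_four {g : Ω → ℝ} (hg : MemLp g 4 P) : MemLp g 2 P :=
  hg.mono_exponent (by norm_num)

theorem FourthMoments.isBoundedProcess {n : ℕ} {E : Fin n → Fin p → Ω → ℝ}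
    (hm : FourthMoments P ψ E) (hψ : ∀ j, Measurable fun q : Ω × Z => ψ j q.1 q.2) :
    ∃ M, IsBoundedProcess P ψ M := by
  obtain ⟨⟨M, hM⟩, -⟩ := hm
  refine ⟨1 + M, hψ, fun j x => memLp_two_of_memLp_four (hM j x).1, fun j x => ?_⟩
  have h4 : Even 4 := by decide
  have h := (hM j x).2
  simp only [h4.pow_abs] at h
  have hi := integrable_pow_four_of_memLp (hM j x).1
  calc ∫ ω, ψ j ω x ^ 2 ∂P ≤ ∫ ω, (1 + ψ j ω x ^ 4) ∂P :=
        integral_mono (memLp_two_of_memLp_four (hM j x).1).integrable_sq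
          ((integrable_const 1).add hi) fun ω => pow_two_le_one_add_pow_four _
    _ = 1 + ∫ ω, ψ j ω x ^ 4 ∂P := by
        rw [integral_add (integrable_const 1) hi]
        simp
    _ ≤ 1 + M := by linarith

theorem sum_integral_mul_eq_implicitKernel (hp : 0 < p)
    (hψ : ∀ j x, MemLp (fun ω => ψ j ω x) 2 P) (x x' : Z) :
    ∑ j, ∫ ω, ψ j ω x * ψ j ω x' ∂P = p * implicitKernel P ψ x x' := by
  have hp' : (p : ℝ) ≠ 0 := by positivity
  have hI : ∀ j, Integrable (fun ω => ψ j ω x * ψ j ω x') P := fun j =>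
    (hψ j x).integrable_mul (hψ j x')
  rw [implicitKernel, integral_finsetSum _ fun j _ => hI j]
  field_simp

theorem IsBoundedProcess.measurable_implicitKernel (hψ : IsBoundedProcess P ψ M) :
    Measurable fun q : Z × Z => implicitKernel P ψ q.1 q.2 := by
  refine Measurable.const_mul (StronglyMeasurable.integral_prod_left'
    (f := fun r : Ω × Z × Z => ∑ j, ψ j r.1 r.2.1 * ψ j r.1 r.2.2) ?_).measurable _
  refine (Finset.measurable_sum _ fun j _ => Measurable.mul ?_ ?_).stronglyMeasurable
  · exact (hψ.measurable j).comp (measurable_fst.prodMk (measurable_fst.comp measurable_snd))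
  · exact (hψ.measurable j).comp (measurable_fst.prodMk (measurable_snd.comp measurable_snd))

/-- The eigenfunctions, replaced by `0` where the eigenvalue vanishes. -/
def eigenfunction (lam : ℕ → ℝ) (u : ℕ → Z → ℝ) (k : ℕ) : Z → ℝ := if lam k = 0 then 0 else u k

theorem eigenfunction_of_pos {lam : ℕ → ℝ} {u : ℕ → Z → ℝ} {k : ℕ} (hk : 0 < lam k) :
    eigenfunction lam u k = u k := if_neg hk.ne'

theorem eigenfunction_of_eq_zero {lam : ℕ → ℝ} {u : ℕ → Z → ℝ} {k : ℕ} (hk : lam k = 0) :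
    eigenfunction lam u k = 0 := if_pos hk

theorem IsEigensystem.isEigenbasis {f : Z → Z → ℝ} {lam : ℕ → ℝ} {u : ℕ → Z → ℝ}
    (h : IsEigensystem μ f lam u) (hf : Measurable fun q : Z × Z => f q.1 q.2) :
    IsEigenbasis μ f lam (eigenfunction lam u) where
  nonneg := h.nonneg
  measurable k := by
    rcases (h.nonneg k).eq_or_lt with hk | hk
    · rw [eigenfunction_of_eq_zero hk.symm]
      exact measurable_zero
    · rw [eigenfunction_of_pos hk]
      have hae := (h.memLp k hk).aestronglyMeasurable
      -- The eigenfunction equation holds at every point, so it upgrades almost everywhere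
      -- measurability of `u k` to measurability.
      have hu : u k = fun x => (lam k)⁻¹ * ∫ x', f x x' * hae.mk _ x' ∂μ := by
        ext x
        have : ∫ x', f x x' * hae.mk _ x' ∂μ = ∫ x', f x x' * u k x' ∂μ := by
          refine integral_congr_ae ?_
          filter_upwards [hae.ae_eq_mk] with y hy
          rw [hy]
        rw [this, h.eigen k hk, inv_mul_cancel_left₀ hk.ne']
      rw [hu]
      refine Measurable.const_mul (StronglyMeasurable.integral_prod_right
        (f := fun x x' => f x x' * hae.mk _ x') ?_).measurable _
      exact hf.stronglyMeasurable.mul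
        (hae.stronglyMeasurable_mk.comp_measurable measurable_snd)
  memLp k := by
    rcases (h.nonneg k).eq_or_lt with hk | hk
    · rw [eigenfunction_of_eq_zero hk.symm]
      exact MemLp.zero
    · rw [eigenfunction_of_pos hk]
      exact h.memLp k hk
  orthonormal k l := by
    rcases (h.nonneg k).eq_or_lt with hk | hk
    · simp [eigenfunction_of_eq_zero hk.symm, hk.symm]
    rcases (h.nonneg l).eq_or_lt with hl | hl
    · have hkl : k ≠ l := by
        rintro rfl
        exact hk.ne hl
      simp [eigenfunction_of_eq_zero hl.symm, hkl]
    · rw [eigenfunction_of_pos hk, eigenfunction_of_pos hl, h.orthonormal k l hk hl]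
      simp [hk]
  eq_zero k hk := eigenfunction_of_eq_zero hk
  eigen k x := by
    rcases (h.nonneg k).eq_or_lt with hk | hk
    · simp [eigenfunction_of_eq_zero hk.symm]
    · rw [eigenfunction_of_pos hk, h.eigen k hk]
  complete g hg hgu := h.complete g hg fun k hk => by
    simpa only [eigenfunction_of_pos hk] using hgu k

/-- The kernel is the covariance averaged over j, so second moments of path integrals, summed over
j, give p times its bilinear form. -/
theorem sum_integral_mul_path_integrals (hp : 0 < p) (hψ : IsBoundedProcess P ψ M) {g h : Z → ℝ}
    (hg : Integrable g μ) (hh : Integrable h μ) :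
    ∑ j, ∫ ω, (∫ x, ψ j ω x * g x ∂μ) * ∫ x, ψ j ω x * h x ∂μ ∂P
      = p * ∫ x, g x * ∫ x', implicitKernel P ψ x x' * h x' ∂μ ∂μ := by
  have hI : ∀ j, Integrable (fun q : Z × Z => ∫ ω, ψ j ω q.1 * g q.1 * (ψ j ω q.2 * h q.2) ∂P)
      (μ.prod μ) := fun j =>
    (integrable_prod_mul_paths (hψ.measurable j) (hψ.memLp j) (hψ.integral_sq_le j) hg
      hh).integral_prod_right
  have hq : ∀ x x', ∑ j, ∫ ω, ψ j ω x * g x * (ψ j ω x' * h x') ∂P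
      = p * (g x * (implicitKernel P ψ x x' * h x')) := by
    intro x x'
    have : ∀ j ω, ψ j ω x * g x * (ψ j ω x' * h x')
        = (g x * h x') * (ψ j ω x * ψ j ω x') := fun j ω => by ring
    simp_rw [this, integral_const_mul]
    rw [← Finset.mul_sum, sum_integral_mul_eq_implicitKernel hp hψ.memLp]
    ring
  have hs : Integrable (fun q : Z × Z => ∑ j, ∫ ω, ψ j ω q.1 * g q.1 * (ψ j ω q.2 * h q.2) ∂P)
      (μ.prod μ) := integrable_finsetSum _ fun j _ => hI j
  simp_rw [fun j => integral_mul_path_integrals (hψ.measurable j) (hψ.memLp j)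
    (hψ.integral_sq_le j) hg hh]
  rw [← integral_finsetSum _ fun j _ => hI j, integral_prod _ hs, ← integral_const_mul]
  refine integral_congr_ae (.of_forall fun x => ?_)
  simp only [hq]
  rw [integral_const_mul, integral_const_mul]

variable {lam : ℕ → ℝ} {e : ℕ → Z → ℝ}

theorem IsEigenbasis.sum_integral_coeff_mul_coeff (hp : 0 < p) (hψ : IsBoundedProcess P ψ M)
    (he : IsEigenbasis μ (implicitKernel P ψ) lam e) (k l : ℕ) :
    ∑ j, ∫ ω, (∫ x, ψ j ω x * e k x ∂μ) * ∫ x, ψ j ω x * e l x ∂μ ∂P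
      = if k = l then p * lam k else 0 := by
  rw [sum_integral_mul_path_integrals hp hψ ((he.memLp k).integrable one_le_two)
    ((he.memLp l).integrable one_le_two)]
  simp_rw [he.eigen]
  have : ∀ x, e k x * (lam l * e l x) = lam l * (e k x * e l x) := fun x => by ring
  simp_rw [this]
  rw [integral_const_mul, he.orthonormal]
  rcases eq_or_ne k l with rfl | hkl
  · rcases (he.nonneg k).eq_or_lt with h | h
    · simp [← h]
    · simp [h]
  · simp [hkl]

theorem IsEigenbasis.integral_coeff_sq_le (hp : 0 < p) (hψ : IsBoundedProcess P ψ M)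
    (he : IsEigenbasis μ (implicitKernel P ψ) lam e) (j : Fin p) (k : ℕ) :
    ∫ ω, (∫ x, ψ j ω x * e k x ∂μ) ^ 2 ∂P ≤ p * lam k := by
  have h := he.sum_integral_coeff_mul_coeff hp hψ k k
  simp only [← sq, if_true] at h
  rw [← h]
  exact Finset.single_le_sum (f := fun j => ∫ ω, (∫ x, ψ j ω x * e k x ∂μ) ^ 2 ∂P)
    (fun i _ => integral_nonneg fun ω => sq_nonneg _) (Finset.mem_univ j)

/-- A vector `h` of the complementary set is killed by the integral operator, so ∑ⱼ 𝔼⟨ψⱼ, h⟩² = p⟨h,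
Th⟩ = 0, with T the integral operator. The set is countable, so almost every path is orthogonal to
all of it at once. -/
theorem IsEigenbasis.ae_hasSum_coeff_sq [SecondCountableTopology (Lp ℝ 2 μ)] (hp : 0 < p)
    (hψ : IsBoundedProcess P ψ M) (he : IsEigenbasis μ (implicitKernel P ψ) lam e) (j : Fin p) :
    ∀ᵐ ω ∂P, HasSum (fun k => (∫ x, ψ j ω x * e k x ∂μ) ^ 2) (∫ x, ψ j ω x ^ 2 ∂μ) := by
  obtain ⟨S, hSc, hS, hpars⟩ := he.exists_countable_parseval
  have h0 : ∀ h ∈ S, ∀ᵐ ω ∂P, ∫ x, ψ j ω x * h x ∂μ = 0 := by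
    intro h hh
    have hi : Integrable h μ := (Lp.memLp h).integrable one_le_two
    have hz := sum_integral_mul_path_integrals hp hψ hi hi
    have hz0 : ∫ x, h x * ∫ x', implicitKernel P ψ x x' * h x' ∂μ ∂μ = 0 := by
      refine integral_eq_zero_of_ae ?_
      filter_upwards [he.complete h (Lp.memLp h) (hS h hh)] with x hx
      simp [hx]
    rw [hz0, mul_zero, Finset.sum_eq_zero_iff_of_nonneg fun i _ =>
      integral_nonneg fun ω => mul_self_nonneg _] at hz
    have hj := hz j (Finset.mem_univ j)
    rw [integral_eq_zero_iff_of_nonneg (fun ω => mul_self_nonneg _)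
      (integrable_mul_path_integrals (hψ.measurable j) (hψ.memLp j) (hψ.integral_sq_le j) hi hi)]
      at hj
    filter_upwards [hj] with ω hω
    simpa using hω
  filter_upwards [(ae_ball_iff hSc).2 h0,
    ae_memLp_path (μ := μ) (hψ.measurable j) (hψ.memLp j) (hψ.integral_sq_le j)] with ω h1 h2
  exact hpars _ h2 h1

/-- A point at which the eigenfunction expansions of all `ψ j` converge with summable mean square
errors. -/
def IsExpansionPoint (P : Measure Ω) (μ : Measure Z) (ψ : Fin p → Ω → Z → ℝ) (e : ℕ → Z → ℝ)
    (x : Z) : Prop :=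
  ∀ j, ∑' N, ∫⁻ ω, ENNReal.ofReal ((ψ j ω x - partialSum μ e (ψ j ω) N x) ^ 2) ∂P ≠ ∞

theorem IsEigenbasis.ae_isExpansionPoint [SecondCountableTopology (Lp ℝ 2 μ)] (hp : 0 < p)
    (hψ : IsBoundedProcess P ψ M) (he : IsEigenbasis μ (implicitKernel P ψ) lam e)
    (hdecay : Summable fun k : ℕ => ((k : ℝ) + 1) * lam k) :
    ∀ᵐ x ∂μ, IsExpansionPoint P μ ψ e x :=
  ae_all_iff.2 fun j => he.ae_tsum_lintegral_sub_partialSum (hψ.measurable j) (hψ.memLp j)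
    (hψ.integral_sq_le j) (he.ae_hasSum_coeff_sq hp hψ j) (he.integral_coeff_sq_le hp hψ j) hdecay

theorem tendsto_of_tendsto_ofReal_sub_sq {a : ℝ} {s : ℕ → ℝ}
    (h : Tendsto (fun N => ENNReal.ofReal ((a - s N) ^ 2)) atTop (𝓝 0)) :
    Tendsto s atTop (𝓝 a) := by
  have h1 := (ENNReal.tendsto_toReal ENNReal.zero_ne_top).comp h
  simp only [Function.comp_def, ENNReal.toReal_ofReal (sq_nonneg _), ENNReal.toReal_zero] at h1
  have h2 := h1.sqrt
  simp only [Real.sqrt_sq_eq_abs, Real.sqrt_zero] at h2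
  have h3 := (tendsto_zero_iff_abs_tendsto_zero _).2 h2
  simpa using (tendsto_const_nhds (x := a)).sub h3

/-- Summability of the expected squared errors makes the errors almost surely summable, so the whole
sequence converges and no subsequence is needed. -/
theorem IsExpansionPoint.ae_tendsto_partialSum (hψ : IsBoundedProcess P ψ M)
    {f : Z → Z → ℝ} (he : IsEigenbasis μ f lam e) {x : Z}
    (hx : IsExpansionPoint P μ ψ e x) (j : Fin p) :
    ∀ᵐ ω ∂P, Tendsto (fun N => partialSum μ e (ψ j ω) N x) atTop (𝓝 (ψ j ω x)) := by
  have hm : ∀ N, Measurable fun ω =>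
      ENNReal.ofReal ((ψ j ω x - partialSum μ e (ψ j ω) N x) ^ 2) := fun N => by
    have h1 : Measurable fun ω => ψ j ω x := (hψ.measurable j).of_uncurry_right
    have h2 : Measurable fun ω => partialSum μ e (ψ j ω) N x :=
      (he.measurable_partialSum (hψ.measurable j) N).comp measurable_prodMk_right
    exact ((h1.sub h2).pow_const 2).ennreal_ofReal
  have h := hx j
  rw [← lintegral_tsum fun N => (hm N).aemeasurable] at h
  filter_upwards [ae_lt_top (Measurable.tsum hm) h] with ω hω
  exact tendsto_of_tendsto_ofReal_sub_sq (ENNReal.tendsto_atTop_zero_of_tsum_ne_top hω.ne)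

theorem IsEigenbasis.memLp_coeff (hψ : IsBoundedProcess P ψ M) {f : Z → Z → ℝ}
    (he : IsEigenbasis μ f lam e) (j : Fin p) (k : ℕ) :
    MemLp (fun ω => ∫ x, ψ j ω x * e k x ∂μ) 2 P := by
  have hi : Integrable (e k) μ := (he.memLp k).integrable one_le_two
  rw [memLp_two_iff_integrable_sq
    (measurable_path_integral (hψ.measurable j) (he.measurable k)).aestronglyMeasurable]
  simpa only [sq] using integrable_mul_path_integrals (hψ.measurable j) (hψ.memLp j)
    (hψ.integral_sq_le j) hi hi

theorem IsEigenbasis.memLp_partialSum_path (hψ : IsBoundedProcess P ψ M) {f : Z → Z → ℝ}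
    (he : IsEigenbasis μ f lam e) (j : Fin p) (N : ℕ) (x : Z) :
    MemLp (fun ω => partialSum μ e (ψ j ω) N x) 2 P :=
  memLp_finsetSum _ fun k _ => (he.memLp_coeff hψ j k).mul_const _

theorem IsExpansionPoint.tendsto_toLp (hψ : IsBoundedProcess P ψ M) {f : Z → Z → ℝ}
    (he : IsEigenbasis μ f lam e) {x : Z} (hx : IsExpansionPoint P μ ψ e x) (j : Fin p) :
    Tendsto (fun N => (he.memLp_partialSum_path hψ j N x).toLp _) atTop
      (𝓝 ((hψ.memLp j x).toLp _)) := by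
  rw [tendsto_iff_norm_sub_tendsto_zero]
  have h := ENNReal.tendsto_atTop_zero_of_tsum_ne_top (hx j)
  have hd : ∀ N, MemLp (fun ω => ψ j ω x - partialSum μ e (ψ j ω) N x) 2 P := fun N =>
    (hψ.memLp j x).sub (he.memLp_partialSum_path hψ j N x)
  -- The norm is written as a difference from 0 so that `tendsto_of_tendsto_ofReal_sub_sq` applies
  -- with limit 0.
  have h1 : ∀ N, ∫⁻ ω, ENNReal.ofReal ((ψ j ω x - partialSum μ e (ψ j ω) N x) ^ 2) ∂P
      = ENNReal.ofReal ((0 - ‖(he.memLp_partialSum_path hψ j N x).toLp _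
        - (hψ.memLp j x).toLp _‖) ^ 2) := by
    intro N
    rw [← ofReal_integral_eq_lintegral_ofReal (hd N).integrable_sq
      (.of_forall fun ω => sq_nonneg _)]
    congr 1
    rw [zero_sub, neg_sq, norm_sub_rev, ← MemLp.toLp_sub, ← real_inner_self_eq_norm_sq,
      inner_toLp_toLp]
    simp only [sq, Pi.sub_apply]
  simp_rw [h1] at h
  exact tendsto_of_tendsto_ofReal_sub_sq h

theorem IsEigenbasis.sum_integral_partialSum_mul (hp : 0 < p) (hψ : IsBoundedProcess P ψ M)
    (he : IsEigenbasis μ (implicitKernel P ψ) lam e) (N : ℕ) (x x' : Z) :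
    ∑ j, ∫ ω, partialSum μ e (ψ j ω) N x * partialSum μ e (ψ j ω) N x' ∂P
      = p * ∑ k ∈ Finset.range N, lam k * (e k x * e k x') := by
  have hI : ∀ j k l, Integrable
      (fun ω => (∫ y, ψ j ω y * e k y ∂μ) * (∫ y, ψ j ω y * e l y ∂μ)) P := fun j k l =>
    MemLp.integrable_mul (he.memLp_coeff hψ j k) (he.memLp_coeff hψ j l)
  have h1 : ∀ j, ∫ ω, partialSum μ e (ψ j ω) N x * partialSum μ e (ψ j ω) N x' ∂P
      = ∑ k ∈ Finset.range N, ∑ l ∈ Finset.range N, (e k x * e l x') *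
        ∫ ω, (∫ y, ψ j ω y * e k y ∂μ) * (∫ y, ψ j ω y * e l y ∂μ) ∂P := by
    intro j
    have h2 : ∀ ω, partialSum μ e (ψ j ω) N x * partialSum μ e (ψ j ω) N x'
        = ∑ k ∈ Finset.range N, ∑ l ∈ Finset.range N, (e k x * e l x') *
          ((∫ y, ψ j ω y * e k y ∂μ) * (∫ y, ψ j ω y * e l y ∂μ)) := by
      intro ω
      rw [partialSum, partialSum, Finset.sum_mul_sum]
      refine Finset.sum_congr rfl fun k _ => Finset.sum_congr rfl fun l _ => ?_
      ring
    simp_rw [h2]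
    rw [integral_finsetSum _ fun k _ => integrable_finsetSum _ fun l _ => (hI j k l).const_mul _]
    refine Finset.sum_congr rfl fun k _ => ?_
    rw [integral_finsetSum _ fun l _ => (hI j k l).const_mul _]
    exact Finset.sum_congr rfl fun l _ => integral_const_mul _ _
  simp_rw [h1]
  rw [Finset.sum_comm, Finset.mul_sum]
  refine Finset.sum_congr rfl fun k hk => ?_
  rw [Finset.sum_comm]
  simp_rw [← Finset.mul_sum, he.sum_integral_coeff_mul_coeff hp hψ]
  simp only [mul_ite, mul_zero, Finset.sum_ite_eq, hk, if_true]
  ring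

/-- At expansion points the kernel is the sum of its eigenfunction expansion. -/
theorem IsEigenbasis.tendsto_sum_eigenfunctions (hp : 0 < p) (hψ : IsBoundedProcess P ψ M)
    (he : IsEigenbasis μ (implicitKernel P ψ) lam e) {x x' : Z}
    (hx : IsExpansionPoint P μ ψ e x) (hx' : IsExpansionPoint P μ ψ e x') :
    Tendsto (fun N => ∑ k ∈ Finset.range N, lam k * (e k x * e k x')) atTop
      (𝓝 (implicitKernel P ψ x x')) := by
  have hp' : (p : ℝ) ≠ 0 := by positivity
  -- Mean square convergence at both points and continuity of the inner product in L²(P) replace an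
  -- appeal to Mercer's theorem.
  have h : Tendsto (fun N => ∑ j, ∫ ω, partialSum μ e (ψ j ω) N x * partialSum μ e (ψ j ω) N x' ∂P)
      atTop (𝓝 (∑ j, ∫ ω, ψ j ω x * ψ j ω x' ∂P)) := by
    refine tendsto_finsetSum _ fun j _ => ?_
    have := (hx.tendsto_toLp hψ he j).inner (𝕜 := ℝ) (hx'.tendsto_toLp hψ he j)
    simpa only [inner_toLp_toLp] using this
  simp_rw [he.sum_integral_partialSum_mul hp hψ,
    sum_integral_mul_eq_implicitKernel hp hψ.memLp] at h
  simpa [hp'] using h.const_mul (p : ℝ)⁻¹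

end RandomFunctions

/-! ### Second moments of the entries of Δ at fixed points. -/

section Moments

variable {Ω Z : Type*} [MeasurableSpace Ω] [MeasurableSpace Z] {P : Measure Ω}
  [IsProbabilityMeasure P] {μ : Measure Z} [IsProbabilityMeasure μ] {n p : ℕ}
  {z : Fin n → Ω → Z} {ψ : Fin p → Ω → Z → ℝ} {E : Fin n → Fin p → Ω → ℝ}

theorem memLp_two_mul_of_memLp_four {g h : Ω → ℝ} (hg : MemLp g 4 P) (hh : MemLp h 4 P) :
    MemLp (fun ω => g ω * h ω) 2 P := by
  refine (memLp_two_iff_integrable_sq (f := fun ω => g ω * h ω)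
    (hg.aestronglyMeasurable.mul hh.aestronglyMeasurable)).2 ?_
  refine Integrable.mono' (((integrable_pow_four_of_memLp hg).add
    (integrable_pow_four_of_memLp hh)).div_const 2)
    ((hg.aestronglyMeasurable.mul hh.aestronglyMeasurable).pow 2) (.of_forall fun ω => ?_)
  rw [Real.norm_of_nonneg (sq_nonneg _)]
  simp only [Pi.add_apply]
  nlinarith [sq_nonneg (g ω ^ 2 - h ω ^ 2)]

theorem variance_mul_le_of_integral_pow_four_le {g h : Ω → ℝ} {M : ℝ} (hg : MemLp g 4 P)
    (hh : MemLp h 4 P) (hgM : ∫ ω, |g ω| ^ 4 ∂P ≤ M) (hhM : ∫ ω, |h ω| ^ 4 ∂P ≤ M) :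
    Var[fun ω => g ω * h ω; P] ≤ M := by
  have h4 : Even 4 := by decide
  simp only [h4.pow_abs] at hgM hhM
  have ig := integrable_pow_four_of_memLp hg
  have ih := integrable_pow_four_of_memLp hh
  have hm := memLp_two_mul_of_memLp_four hg hh
  calc Var[fun ω => g ω * h ω; P] ≤ ∫ ω, (g ω * h ω) ^ 2 ∂P :=
        variance_le_expectation_sq hm.aestronglyMeasurable
    _ ≤ ∫ ω, (g ω ^ 4 + h ω ^ 4) / 2 ∂P :=
        integral_mono hm.integrable_sq ((ig.add ih).div_const 2) fun ω => by
          simp only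
          nlinarith [sq_nonneg (g ω ^ 2 - h ω ^ 2)]
    _ = (∫ ω, g ω ^ 4 ∂P + ∫ ω, h ω ^ 4 ∂P) / 2 := by rw [integral_div, integral_add ig ih]
    _ ≤ M := by linarith

theorem FourthMoments.sum_variance_le (hp : 0 < p) (hm : FourthMoments P ψ E) (x x' : Z) :
    ∑ j, Var[fun ω => ψ j ω x * ψ j ω x'; P] ≤ p * v₁ P ψ := by
  obtain ⟨⟨M, hM⟩, -⟩ := hm
  have hp' : (0 : ℝ) < p := by positivity
  -- A supremum in ℝ dominates its family only if the family is bounded; the uniform fourth moments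
  -- ensure this.
  have hb : BddAbove (Set.range fun q : Z × Z =>
      (1 / (p : ℝ)) * ∑ j, Var[fun ω => ψ j ω q.1 * ψ j ω q.2; P]) := by
    refine ⟨(1 / (p : ℝ)) * ∑ _j : Fin p, M, ?_⟩
    rintro _ ⟨q, rfl⟩
    simp only
    gcongr with j
    exact variance_mul_le_of_integral_pow_four_le (hM j _).1 (hM j _).1 (hM j _).2 (hM j _).2
  have h := le_ciSup hb (x, x')
  rw [← div_le_iff₀' hp', v₁, div_eq_inv_mul, ← one_div]
  exact h

theorem IsBoundedProcess.sum_integral_sq_le {M : ℝ} (hp : 0 < p) (hψ : IsBoundedProcess P ψ M)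
    (x : Z) : ∑ j, ∫ ω, ψ j ω x ^ 2 ∂P ≤ p * v₂ P ψ := by
  have hp' : (0 : ℝ) < p := by positivity
  have hb : BddAbove (Set.range fun x : Z => (1 / (p : ℝ)) * ∑ j, ∫ ω, |ψ j ω x| ^ 2 ∂P) := by
    refine ⟨(1 / (p : ℝ)) * ∑ _j : Fin p, M, ?_⟩
    rintro _ ⟨q, rfl⟩
    simp only [sq_abs]
    gcongr with j
    exact hψ.integral_sq_le j _
  have h := le_ciSup hb x
  rw [← div_le_iff₀' hp', v₂, div_eq_inv_mul, ← one_div]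
  simp only [sq_abs] at h ⊢
  exact h

theorem integral_pow_four_le_v₃ (i : Fin n) (j : Fin p) : ∫ ω, |E i j ω| ^ 4 ∂P ≤ v₃ P E :=
  le_ciSup (f := fun q : Fin n × Fin p => ∫ ω, |E q.1 q.2 ω| ^ 4 ∂P)
    (Set.finite_range _).bddAbove (i, j)

theorem v₁_nonneg : 0 ≤ v₁ P ψ :=
  Real.iSup_nonneg fun _ => mul_nonneg (by positivity)
    (Finset.sum_nonneg fun _ _ => variance_nonneg _ _)

theorem v₂_nonneg : 0 ≤ v₂ P ψ :=
  Real.iSup_nonneg fun _ => mul_nonneg (by positivity)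
    (Finset.sum_nonneg fun _ _ => integral_nonneg fun _ => by positivity)

theorem v₃_nonneg : 0 ≤ v₃ P E :=
  Real.iSup_nonneg fun _ => integral_nonneg fun _ => by positivity

theorem integral_sub_mean_sq_of_pairwise_indep {Y : Fin p → Ω → ℝ} (hY : ∀ j, MemLp (Y j) 2 P)
    (hi : Pairwise fun j l => IndepFun (Y j) (Y l) P) :
    ∫ ω, (∑ j, Y j ω - ∑ j, ∫ ω, Y j ω ∂P) ^ 2 ∂P = ∑ j, Var[Y j; P] := by
  rw [← IndepFun.variance_sum (s := Finset.univ) (fun j _ => hY j) fun j _ l _ hjl => hi hjl,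
    variance_eq_integral (memLp_finsetSum' _ fun j _ => hY j).aestronglyMeasurable.aemeasurable]
  simp only [Finset.sum_apply]
  rw [integral_finsetSum _ fun j _ => (hY j).integrable one_le_two]

theorem integral_signal_sq_le (hp : 0 < p) (hm : FourthMoments P ψ E) (hindep : iIndepFun ψ P)
    (x x' : Z) :
    ∫ ω, (∑ j, ψ j ω x * ψ j ω x' - p * implicitKernel P ψ x x') ^ 2 ∂P ≤ p * v₁ P ψ := by
  refine le_trans (le_of_eq ?_) (hm.sum_variance_le hp x x')
  obtain ⟨⟨M, hM⟩, -⟩ := hm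
  rw [← sum_integral_mul_eq_implicitKernel hp fun j x => memLp_two_of_memLp_four (hM j x).1]
  refine integral_sub_mean_sq_of_pairwise_indep
    (fun j => memLp_two_mul_of_memLp_four (hM j x).1 (hM j x').1) fun j l hjl => ?_
  have hφ : Measurable fun v : Z → ℝ => v x * v x' :=
    (measurable_pi_apply x).mul (measurable_pi_apply x')
  exact (hindep.indepFun hjl).comp hφ hφ

theorem IsLatentMetricModel.memLp_mul (hmodel : IsLatentMetricModel P μ z ψ E)
    (hψ : ∀ j x, MemLp (fun ω => ψ j ω x) 2 P) (x : Z) (i : Fin n) (j : Fin p) :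
    MemLp (fun ω => ψ j ω x * E i j ω) 2 P := by
  have hmψ : Measurable fun ω => ψ j ω x := (hmodel.measurable_ψ j).of_uncurry_right
  refine (memLp_two_iff_integrable_sq (f := fun ω => ψ j ω x * E i j ω)
    (hmψ.mul (hmodel.measurable_E i j)).aestronglyMeasurable).2 ?_
  have h := hmodel.indep_ψ_E.comp (φ := fun v : Fin p → Z → ℝ => v j x ^ 2)
    (ψ := fun v : Fin n → Fin p → ℝ => v i j ^ 2) (by fun_prop) (by fun_prop)
  have h2 := h.integrable_mul (hψ j x).integrable_sq (hmodel.memLp_E i j).integrable_sq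
  refine h2.congr (.of_forall fun ω => ?_)
  simp only [Function.comp_apply, Pi.mul_apply]
  ring

theorem IsLatentMetricModel.integral_noise_mul_noise_of_ne
    (hmodel : IsLatentMetricModel P μ z ψ E) {q r : Fin n × Fin p} (hqr : q ≠ r) :
    ∫ ω, E q.1 q.2 ω * E r.1 r.2 ω ∂P = 0 := by
  have h := (hmodel.indep_E.indepFun hqr).integral_fun_mul_eq_mul_integral
    (hmodel.measurable_E _ _).aestronglyMeasurable (hmodel.measurable_E _ _).aestronglyMeasurable
  rw [h, hmodel.mean_E, zero_mul]

theorem IsLatentMetricModel.integral_noise_mul_self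
    (hmodel : IsLatentMetricModel P μ z ψ E) (i : Fin n) (j : Fin p) :
    ∫ ω, E i j ω * E i j ω ∂P = 1 := by
  have h := hmodel.var_E i j
  rw [variance_eq_sub (hmodel.memLp_E i j), hmodel.mean_E i j] at h
  simpa [sq] using h

/-- The noise is independent of the signal, and its entries are centred, uncorrelated and of unit
variance, so only the diagonal terms of the square survive. -/
theorem IsLatentMetricModel.integral_cross_sq_le (hmodel : IsLatentMetricModel P μ z ψ E) {M : ℝ}
    (hp : 0 < p) (hψ : IsBoundedProcess P ψ M) (x : Z) (i : Fin n) :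
    ∫ ω, (∑ j, ψ j ω x * E i j ω) ^ 2 ∂P ≤ p * v₂ P ψ := by
  refine le_trans (le_of_eq ?_) (hψ.sum_integral_sq_le hp x)
  have hI : ∀ j l, Integrable (fun ω => (ψ j ω x * E i j ω) * (ψ l ω x * E i l ω)) P := fun j l =>
    (hmodel.memLp_mul hψ.memLp x i j).integrable_mul (hmodel.memLp_mul hψ.memLp x i l)
  have hjl : ∀ j l, ∫ ω, (ψ j ω x * E i j ω) * (ψ l ω x * E i l ω) ∂P
      = if j = l then ∫ ω, ψ j ω x ^ 2 ∂P else 0 := by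
    intro j l
    have h := hmodel.indep_ψ_E.comp (φ := fun v : Fin p → Z → ℝ => v j x * v l x)
      (ψ := fun v : Fin n → Fin p → ℝ => v i j * v i l) (by fun_prop) (by fun_prop)
    have hm : ∀ j, Measurable fun ω => ψ j ω x := fun j =>
      (hmodel.measurable_ψ j).of_uncurry_right
    have h2 := h.integral_fun_mul_eq_mul_integral ((hm j).mul (hm l)).aestronglyMeasurable
      ((hmodel.measurable_E i j).mul (hmodel.measurable_E i l)).aestronglyMeasurable
    simp only [Function.comp_apply] at h2
    have h3 : ∀ ω, (ψ j ω x * E i j ω) * (ψ l ω x * E i l ω)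
        = (ψ j ω x * ψ l ω x) * (E i j ω * E i l ω) := fun ω => by ring
    simp_rw [h3]
    rw [h2]
    split_ifs with hjl
    · subst hjl
      rw [hmodel.integral_noise_mul_self, mul_one]
      simp only [sq]
    · rw [hmodel.integral_noise_mul_noise_of_ne (q := (i, j)) (r := (i, l)) (by simpa using hjl),
        mul_zero]
  simp_rw [sq (∑ j, _), Finset.sum_mul_sum]
  rw [integral_finsetSum _ fun j _ => integrable_finsetSum _ fun l _ => hI j l]
  refine Finset.sum_congr rfl fun j _ => ?_
  rw [integral_finsetSum _ fun l _ => hI j l]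
  simp [hjl]

theorem IsLatentMetricModel.integral_noise_sq_le (hmodel : IsLatentMetricModel P μ z ψ E)
    (hm : FourthMoments P ψ E) (i i' : Fin n) :
    ∫ ω, (∑ j, E i j ω * E i' j ω - p * (1 : Matrix (Fin n) (Fin n) ℝ) i i') ^ 2 ∂P
      ≤ p * v₃ P E := by
  have hmean : ∑ j, ∫ ω, E i j ω * E i' j ω ∂P = p * (1 : Matrix (Fin n) (Fin n) ℝ) i i' := by
    rw [Matrix.one_apply]
    split_ifs with h
    · subst h
      simp [hmodel.integral_noise_mul_self]
    · rw [mul_zero]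
      exact Finset.sum_eq_zero fun j _ =>
        hmodel.integral_noise_mul_noise_of_ne (q := (i, j)) (r := (i', j)) (by simp [h])
  rw [← hmean, integral_sub_mean_sq_of_pairwise_indep
    fun j => memLp_two_mul_of_memLp_four (hm.2 i j) (hm.2 i' j)]
  · calc ∑ j, Var[fun ω => E i j ω * E i' j ω; P] ≤ ∑ _j : Fin p, v₃ P E :=
          Finset.sum_le_sum fun j _ => variance_mul_le_of_integral_pow_four_le (hm.2 i j)
            (hm.2 i' j) (integral_pow_four_le_v₃ i j) (integral_pow_four_le_v₃ i' j)
      _ = p * v₃ P E := by simp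
  -- For j ≠ l the products use disjoint sets of noise entries, also when i = i'.
  · intro j l hjl
    have h := hmodel.indep_E.indepFun_prodMk_prodMk (fun q => hmodel.measurable_E q.1 q.2)
      (i, j) (i', j) (i, l) (i', l) (by simp [hjl]) (by simp [hjl]) (by simp [hjl]) (by simp [hjl])
    exact h.comp (φ := fun q : ℝ × ℝ => q.1 * q.2) (ψ := fun q : ℝ × ℝ => q.1 * q.2)
      (by fun_prop) (by fun_prop)

/-- The entry of `Δ` for signals `s`, `s'` at two points with kernel value `κ` and noise vectors
`a`, `a'`; the number `d` is `1` on the diagonal and `0` elsewhere. -/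
def perturbationEntry (σ κ d : ℝ) (s s' a a' : Fin p → ℝ) : ℝ :=
  (p : ℝ)⁻¹ * ((∑ j, s j * s' j - p * κ) + σ * (∑ j, s j * a' j + ∑ j, s' j * a j)
    + σ ^ 2 * (∑ j, a j * a' j - p * d))

/-- This is (A + B + C)² ≤ 3(A² + B² + C²), with (B + B')² ≤ 2(B² + B'²) for the two cross terms. -/
theorem sq_perturbationEntry_le (σ κ d : ℝ) (s s' a a' : Fin p → ℝ) :
    perturbationEntry σ κ d s s' a a' ^ 2 ≤ (p : ℝ)⁻¹ ^ 2 * (3 * ((∑ j, s j * s' j - p * κ) ^ 2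
      + σ ^ 2 * (2 * ((∑ j, s j * a' j) ^ 2 + (∑ j, s' j * a j) ^ 2))
      + σ ^ 4 * (∑ j, a j * a' j - p * d) ^ 2)) := by
  rw [perturbationEntry, mul_pow]
  gcongr
  generalize (∑ j, s j * s' j - p * κ) = A
  generalize (∑ j, s j * a' j) = B
  generalize (∑ j, s' j * a j) = B'
  generalize (∑ j, a j * a' j - p * d) = C
  nlinarith [sq_nonneg (A - σ * (B + B')), sq_nonneg (A - σ ^ 2 * C),
    sq_nonneg (σ * (B + B') - σ ^ 2 * C), mul_nonneg (sq_nonneg σ) (sq_nonneg (B - B'))]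

theorem lintegral_ofReal_combination_le {A B B' C : Ω → ℝ} {a b c r s t : ℝ} (hr : 0 ≤ r)
    (hs : 0 ≤ s) (ht : 0 ≤ t) (hA0 : ∀ ω, 0 ≤ A ω) (hB0 : ∀ ω, 0 ≤ B ω) (hB'0 : ∀ ω, 0 ≤ B' ω)
    (hC0 : ∀ ω, 0 ≤ C ω) (iA : Integrable A P) (iB : Integrable B P) (iB' : Integrable B' P)
    (iC : Integrable C P) (hA : ∫ ω, A ω ∂P ≤ a) (hB : ∫ ω, B ω ∂P ≤ b) (hB' : ∫ ω, B' ω ∂P ≤ b)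
    (hC : ∫ ω, C ω ∂P ≤ c) :
    ∫⁻ ω, ENNReal.ofReal (r * (3 * (A ω + s * (2 * (B ω + B' ω)) + t * C ω))) ∂P
      ≤ ENNReal.ofReal (r * (3 * (a + s * (2 * (b + b)) + t * c))) := by
  have iBB : Integrable (fun ω => s * (2 * (B ω + B' ω))) P :=
    ((iB.add iB').const_mul 2).const_mul s
  have iAB : Integrable (fun ω => A ω + s * (2 * (B ω + B' ω))) P := iA.add iBB
  have iABC : Integrable (fun ω => r * (3 * (A ω + s * (2 * (B ω + B' ω)) + t * C ω))) P :=
    ((iAB.add (iC.const_mul t)).const_mul 3).const_mul r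
  rw [← ofReal_integral_eq_lintegral_ofReal iABC (.of_forall fun ω => by
    have := hA0 ω
    have := hB0 ω
    have := hB'0 ω
    have := hC0 ω
    simp only [Pi.zero_apply]
    positivity)]
  apply ENNReal.ofReal_le_ofReal
  rw [integral_const_mul, integral_const_mul, integral_add iAB (iC.const_mul t),
    integral_add iA iBB, integral_const_mul, integral_const_mul, integral_const_mul,
    integral_add iB iB']
  gcongr

/-- Each sum contributes p times its constant against the prefactor p⁻². The 4 is the factor 2 from
splitting the cross terms times their number. -/
theorem IsLatentMetricModel.lintegral_perturbationEntry_sq_le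
    (hmodel : IsLatentMetricModel P μ z ψ E) (hp : 0 < p) (hm : FourthMoments P ψ E)
    (hindep : iIndepFun ψ P) (σ : ℝ) (x x' : Z) (i i' : Fin n) :
    ∫⁻ ω, ENNReal.ofReal (perturbationEntry σ (implicitKernel P ψ x x')
      ((1 : Matrix (Fin n) (Fin n) ℝ) i i') (fun j => ψ j ω x) (fun j => ψ j ω x')
      (fun j => E i j ω) (fun j => E i' j ω) ^ 2) ∂P
      ≤ ENNReal.ofReal (3 * (v₁ P ψ + 4 * σ ^ 2 * v₂ P ψ + σ ^ 4 * v₃ P E) / p) := by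
  obtain ⟨M, hψ⟩ := hm.isBoundedProcess hmodel.measurable_ψ
  have hp' : (0 : ℝ) < p := by positivity
  have iA : Integrable
      (fun ω => (∑ j, ψ j ω x * ψ j ω x' - p * implicitKernel P ψ x x') ^ 2) P :=
    MemLp.integrable_sq ((memLp_finsetSum _ fun j _ => memLp_two_mul_of_memLp_four
      (hm.1.choose_spec j x).1 (hm.1.choose_spec j x').1).sub (memLp_const _))
  have iB : ∀ x i, Integrable (fun ω => (∑ j, ψ j ω x * E i j ω) ^ 2) P := fun x i =>
    MemLp.integrable_sq (memLp_finsetSum _ fun j _ => hmodel.memLp_mul hψ.memLp x i j)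
  have iC : Integrable
      (fun ω => (∑ j, E i j ω * E i' j ω - p * (1 : Matrix (Fin n) (Fin n) ℝ) i i') ^ 2) P :=
    MemLp.integrable_sq ((memLp_finsetSum _ fun j _ => memLp_two_mul_of_memLp_four
      (hm.2 i j) (hm.2 i' j)).sub (memLp_const _))
  refine (lintegral_mono fun ω => ENNReal.ofReal_le_ofReal
    (sq_perturbationEntry_le σ _ _ _ _ _ _)).trans ?_
  refine (lintegral_ofReal_combination_le (by positivity) (by positivity) (by positivity)
    (fun ω => sq_nonneg _) (fun ω => sq_nonneg _) (fun ω => sq_nonneg _) (fun ω => sq_nonneg _)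
    iA (iB x i') (iB x' i) iC (integral_signal_sq_le hp hm hindep x x')
    (hmodel.integral_cross_sq_le hp hψ x i') (hmodel.integral_cross_sq_le hp hψ x' i)
    (hmodel.integral_noise_sq_le hm i i')).trans (le_of_eq ?_)
  congr 1
  field_simp
  ring

end Moments

/-! ### Freezing one of two independent variables. -/

section Independence

variable {Ω α β : Type*} [MeasurableSpace Ω] [MeasurableSpace α] [MeasurableSpace β]
  {P : Measure Ω} [IsProbabilityMeasure P] {U : Ω → α} {Y : Ω → β}

/-- The joint law is a product, so Fubini fixes the value of `U` first. The sets `U ⁻¹' A` exhaust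
the σ-algebra of `U`, so this bounds a conditional expectation without conditional distributions. -/
theorem setLIntegral_comp_le_of_indepFun (hU : Measurable U) (hY : Measurable Y)
    (hUY : IndepFun U Y P) {F : α × β → ℝ≥0∞} (hF : Measurable F) {V : ℝ≥0∞}
    (hV : ∀ᵐ ω' ∂P, ∫⁻ ω, F (U ω', Y ω) ∂P ≤ V) {A : Set α} (hA : MeasurableSet A) :
    ∫⁻ ω in U ⁻¹' A, F (U ω, Y ω) ∂P ≤ V * P (U ⁻¹' A) := by
  have hG : Measurable fun q : α × β => A.indicator 1 q.1 * F q :=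
    ((measurable_one.indicator hA).comp measurable_fst).mul hF
  calc ∫⁻ ω in U ⁻¹' A, F (U ω, Y ω) ∂P
      = ∫⁻ ω, A.indicator 1 (U ω) * F (U ω, Y ω) ∂P := by
        rw [← lintegral_indicator (hU hA)]
        refine lintegral_congr fun ω => ?_
        by_cases h : U ω ∈ A <;> simp [Set.indicator, h]
    _ = ∫⁻ q, A.indicator 1 q.1 * F q ∂(P.map fun ω => (U ω, Y ω)) :=
        (lintegral_map hG (hU.prodMk hY)).symm
    _ = ∫⁻ x, ∫⁻ y, A.indicator 1 x * F (x, y) ∂(P.map Y) ∂(P.map U) := by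
        have := Measure.isProbabilityMeasure_map (μ := P) hY.aemeasurable
        rw [(indepFun_iff_map_prod_eq_prod_map_map hU.aemeasurable hY.aemeasurable).1 hUY,
          lintegral_prod _ hG.aemeasurable]
    _ = ∫⁻ ω', A.indicator 1 (U ω') * ∫⁻ ω, F (U ω', Y ω) ∂P ∂P := by
        have := Measure.isProbabilityMeasure_map (μ := P) hY.aemeasurable
        rw [lintegral_map hG.lintegral_prod_right' hU]
        refine lintegral_congr fun ω' => ?_
        rw [lintegral_map (f := fun y => A.indicator 1 (U ω') * F (U ω', y))
          (hG.comp measurable_prodMk_left) hY,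
          lintegral_const_mul (f := fun ω => F (U ω', Y ω)) _
            ((hF.comp measurable_prodMk_left).comp hY)]
    _ ≤ ∫⁻ ω', A.indicator 1 (U ω') * V ∂P := by
        refine lintegral_mono_ae ?_
        filter_upwards [hV] with ω' h
        gcongr
    _ = V * P (U ⁻¹' A) := by
        rw [lintegral_mul_const (f := fun ω' => A.indicator 1 (U ω')) _ ((measurable_one.indicator hA).comp hU), mul_comm]
        congr 1
        exact lintegral_indicator_one (hU hA)

/-- The preceding bound with V = 0, applied to the indicator of the complement of `Q`. -/
theorem ae_of_indepFun (hU : Measurable U) (hY : Measurable Y) (hUY : IndepFun U Y P)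
    {Q : Set (α × β)} (hQ : MeasurableSet Q) (h : ∀ᵐ ω' ∂P, ∀ᵐ ω ∂P, (U ω', Y ω) ∈ Q) :
    ∀ᵐ ω ∂P, (U ω, Y ω) ∈ Q := by
  have hF : Measurable (Qᶜ.indicator (1 : α × β → ℝ≥0∞)) := measurable_one.indicator hQ.compl
  have h0 := setLIntegral_comp_le_of_indepFun hU hY hUY hF (V := 0) (A := Set.univ) (by
    filter_upwards [h] with ω' h'
    rw [nonpos_iff_eq_zero,
      lintegral_eq_zero_iff (f := fun ω => Qᶜ.indicator 1 (U ω', Y ω))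
        ((hF.comp measurable_prodMk_left).comp hY)]
    filter_upwards [h'] with ω hω
    simp [hω]) MeasurableSet.univ
  rw [zero_mul, nonpos_iff_eq_zero, Set.preimage_univ, Measure.restrict_univ,
    lintegral_eq_zero_iff (f := fun ω => Qᶜ.indicator 1 (U ω, Y ω)) (hF.comp (hU.prodMk hY))] at h0
  filter_upwards [h0] with ω hω
  by_contra hc
  simp [hc] at hω

end Independence

/-! ### Δ as a function of latent variables, coefficients and noise. -/

section Limit

variable {Ω Z : Type*} [MeasurableSpace Ω] [MeasurableSpace Z] {P : Measure Ω}
  [IsProbabilityMeasure P] {μ : Measure Z} [IsProbabilityMeasure μ] {n p : ℕ}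
  {z : Fin n → Ω → Z} {ψ : Fin p → Ω → Z → ℝ} {E : Fin n → Fin p → Ω → ℝ}
  {lam : ℕ → ℝ} {e : ℕ → Z → ℝ} {f : Z → Z → ℝ} {σ M : ℝ}

/-- The sum of the series `∑ k, w k * e k x`. -/
def coeffSum (e : ℕ → Z → ℝ) (w : ℕ → ℝ) (x : Z) : ℝ :=
  limsup (fun N => ∑ k ∈ Finset.range N, w k * e k x) atTop

theorem measurable_coeff_partial (he : ∀ k, Measurable (e k)) {α : Type*} [MeasurableSpace α]
    {w : α → ℕ → ℝ} {g : α → Z} (hw : Measurable w) (hg : Measurable g) (N : ℕ) :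
    Measurable fun a => ∑ k ∈ Finset.range N, w a k * e k (g a) :=
  Finset.measurable_sum _ fun k _ => ((measurable_pi_apply k).comp hw).mul ((he k).comp hg)

theorem measurable_coeffSum (he : ∀ k, Measurable (e k)) {α : Type*} [MeasurableSpace α]
    {w : α → ℕ → ℝ} {g : α → Z} (hw : Measurable w) (hg : Measurable g) :
    Measurable fun a => coeffSum e (w a) (g a) :=
  Measurable.limsup fun N => measurable_coeff_partial he hw hg N

/-- The coefficients of the random functions in the eigenfunctions, and the noise. -/
def coeffNoise (μ : Measure Z) (ψ : Fin p → Ω → Z → ℝ) (E : Fin n → Fin p → Ω → ℝ)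
    (e : ℕ → Z → ℝ) (ω : Ω) : (Fin p → ℕ → ℝ) × (Fin n → Fin p → ℝ) :=
  (fun j k => ∫ x, ψ j ω x * e k x ∂μ, fun i j => E i j ω)

theorem IsLatentMetricModel.measurable_coeffNoise (hmodel : IsLatentMetricModel P μ z ψ E)
    (he : ∀ k, Measurable (e k)) : Measurable (coeffNoise μ ψ E e) :=
  (measurable_pi_lambda _ fun j => measurable_pi_lambda _ fun k =>
    measurable_path_integral (hmodel.measurable_ψ j) (he k)).prodMk
      (measurable_pi_lambda _ fun i => measurable_pi_lambda _ fun j => hmodel.measurable_E i j)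

theorem IsLatentMetricModel.measurable_latent (hmodel : IsLatentMetricModel P μ z ψ E) :
    Measurable fun ω i => z i ω := measurable_pi_lambda _ hmodel.measurable_z

/-- The matrix `Δ` as a function of the latent variables, the coefficients and the noise. -/
def limitMatrix (f : Z → Z → ℝ) (e : ℕ → Z → ℝ) (σ : ℝ)
    (q : (Fin n → Z) × (Fin p → ℕ → ℝ) × (Fin n → Fin p → ℝ)) (i i' : Fin n) : ℝ :=
  perturbationEntry σ (f (q.1 i) (q.1 i')) ((1 : Matrix (Fin n) (Fin n) ℝ) i i')
    (fun j => coeffSum e (q.2.1 j) (q.1 i)) (fun j => coeffSum e (q.2.1 j) (q.1 i'))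
    (q.2.2 i) (q.2.2 i')

theorem measurable_limitMatrix (hf : Measurable fun q : Z × Z => f q.1 q.2)
    (he : ∀ k, Measurable (e k)) (i i' : Fin n) :
    Measurable fun q : (Fin n → Z) × (Fin p → ℕ → ℝ) × (Fin n → Fin p → ℝ) =>
      limitMatrix f e σ q i i' := by
  have h1 : ∀ i j, Measurable fun q : (Fin n → Z) × (Fin p → ℕ → ℝ) × (Fin n → Fin p → ℝ) =>
      coeffSum e (q.2.1 j) (q.1 i) := fun i j =>
    measurable_coeffSum he (by fun_prop) (by fun_prop)
  have h2 : Measurable fun q : (Fin n → Z) × (Fin p → ℕ → ℝ) × (Fin n → Fin p → ℝ) =>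
      f (q.1 i) (q.1 i') :=
    hf.comp (f := fun q : (Fin n → Z) × (Fin p → ℕ → ℝ) × (Fin n → Fin p → ℝ) =>
      (q.1 i, q.1 i')) (by fun_prop)
  have h3 : ∀ i j, Measurable fun q : (Fin n → Z) × (Fin p → ℕ → ℝ) × (Fin n → Fin p → ℝ) =>
      q.2.2 i j := by fun_prop
  refine Measurable.const_mul (((Measurable.sub ?_ (h2.const_mul _)).add
    (Measurable.const_mul (Measurable.add ?_ ?_) _)).add
      (Measurable.const_mul (Measurable.sub_const ?_ _) _)) _
  · exact Finset.measurable_sum _ fun j _ => (h1 i j).mul (h1 i' j)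
  · exact Finset.measurable_sum _ fun j _ => (h1 i j).mul (h3 i' j)
  · exact Finset.measurable_sum _ fun j _ => (h1 i' j).mul (h3 i j)
  · exact Finset.measurable_sum _ fun j _ => (h3 i j).mul (h3 i' j)

theorem sqrt_mul_inv_sqrt_mul {a b : ℝ} (ha : 0 < a) : √a * (√(a * b))⁻¹ = (√b)⁻¹ := by
  rw [Real.sqrt_mul ha.le, mul_inv, ← mul_assoc, mul_inv_cancel₀ (Real.sqrt_pos.2 ha).ne', one_mul]

/-- The factors √λₖ cancel, leaving one term of the expansion of ψⱼ at `x`; both sides vanish if λₖ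
= 0. -/
theorem feature_mul_W {lam : ℕ → ℝ} (hlam : ∀ k, 0 ≤ lam k) (u : ℕ → Z → ℝ) (x : Z) (ω : Ω)
    (j : Fin p) (k : ℕ) :
    feature lam u k x * W μ ψ lam u ω j k
      = (√(p : ℝ))⁻¹ * ((∫ y, ψ j ω y * eigenfunction lam u k y ∂μ) * eigenfunction lam u k x) := by
  rcases (hlam k).eq_or_lt with hk | hk
  · simp [W, eigenfunction_of_eq_zero hk.symm, ← hk]
  · rw [eigenfunction_of_pos hk, W, if_neg hk.ne', feature, ← sqrt_mul_inv_sqrt_mul (b := p) hk]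
    ring

theorem feature_mul_feature {lam : ℕ → ℝ} (hlam : ∀ k, 0 ≤ lam k) (u : ℕ → Z → ℝ) (x x' : Z)
    (k : ℕ) : feature lam u k x * feature lam u k x'
      = lam k * (eigenfunction lam u k x * eigenfunction lam u k x') := by
  rcases (hlam k).eq_or_lt with hk | hk
  · simp [feature, ← hk]
  · rw [eigenfunction_of_pos hk, feature, feature, mul_mul_mul_comm, Real.mul_self_sqrt hk.le]

open scoped Matrix in
theorem DeltaTrunc_apply {lam : ℕ → ℝ} (hlam : ∀ k, 0 ≤ lam k) (hp : 0 < p) (u : ℕ → Z → ℝ)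
    (N : ℕ) (ω : Ω) (i i' : Fin n) :
    DeltaTrunc μ z ψ E σ lam u N ω i i'
      = perturbationEntry σ (∑ k ∈ Finset.range N, lam k *
          (eigenfunction lam u k (z i ω) * eigenfunction lam u k (z i' ω)))
        ((1 : Matrix (Fin n) (Fin n) ℝ) i i')
        (fun j => partialSum μ (eigenfunction lam u) (ψ j ω) N (z i ω))
        (fun j => partialSum μ (eigenfunction lam u) (ψ j ω) N (z i' ω))
        (fun j => E i j ω) (fun j => E i' j ω) := by
  have hp' : (0 : ℝ) < p := by positivity
  set F := PhiTrunc z lam u N ω with hF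
  set V := WTrunc μ ψ lam u N ω with hV
  set A : Matrix (Fin n) (Fin p) ℝ := noiseMatrix E ω with hA
  set S : Matrix (Fin n) (Fin p) ℝ :=
    Matrix.of fun i j => partialSum μ (eigenfunction lam u) (ψ j ω) N (z i ω) with hS
  have hFV : F * Vᵀ = (√(p : ℝ))⁻¹ • S := by
    ext a j
    simp only [Matrix.mul_apply, Matrix.transpose_apply, Matrix.smul_apply, hF, hV, hS, PhiTrunc,
      WTrunc, Matrix.of_apply, feature_mul_W hlam, smul_eq_mul, partialSum]
    rw [← Finset.mul_sum, Finset.sum_range]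
  have hVF : V * Fᵀ = (√(p : ℝ))⁻¹ • Sᵀ := by
    rw [← Matrix.transpose_smul, ← hFV, Matrix.transpose_mul, Matrix.transpose_transpose]
  have hFF : (F * Fᵀ) i i' = ∑ k ∈ Finset.range N, lam k *
      (eigenfunction lam u k (z i ω) * eigenfunction lam u k (z i' ω)) := by
    simp only [Matrix.mul_apply, Matrix.transpose_apply, hF, PhiTrunc, Matrix.of_apply,
      feature_mul_feature hlam]
    rw [Finset.sum_range]
  have hs : (√(p : ℝ))⁻¹ * (√(p : ℝ))⁻¹ = (p : ℝ)⁻¹ := by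
    rw [← mul_inv, Real.mul_self_sqrt hp'.le]
  have h1 : F * (Vᵀ * V - 1) * Fᵀ = (p : ℝ)⁻¹ • (S * Sᵀ) - F * Fᵀ := by
    rw [Matrix.mul_sub, Matrix.sub_mul, Matrix.mul_one, ← Matrix.mul_assoc, Matrix.mul_assoc _ V,
      hFV, hVF, Matrix.smul_mul, Matrix.mul_smul, smul_smul, hs]
  have hD : DeltaTrunc μ z ψ E σ lam u N ω = (p : ℝ)⁻¹ • (S * Sᵀ) - F * Fᵀ
      + ((p : ℝ)⁻¹ * σ) • (S * Aᵀ + A * Sᵀ)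
      + ((p : ℝ)⁻¹ * σ ^ 2) • (A * Aᵀ - (p : ℝ) • (1 : Matrix (Fin n) (Fin n) ℝ)) := by
    rw [← h1]
    simp only [DeltaTrunc, ← hF, ← hV, ← hA]
    rw [hFV, Matrix.mul_assoc A, hVF, Matrix.smul_mul, Matrix.mul_smul, ← smul_add, smul_smul]
    congr 3
    rw [← hs]
    ring
  rw [hD]
  simp only [Matrix.add_apply, Matrix.sub_apply, Matrix.smul_apply, hFF, smul_eq_mul,
    perturbationEntry]
  simp only [Matrix.mul_apply, Matrix.transpose_apply, hS, hA, noiseMatrix, Matrix.of_apply]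
  simp only [mul_comm (E i _ ω) (partialSum _ _ _ _ _)]
  field_simp

theorem tendsto_perturbationEntry {d : ℝ} {κ : ℕ → ℝ} {κ₀ : ℝ} {s s' : ℕ → Fin p → ℝ}
    {s₀ s₀' : Fin p → ℝ} {a a' : Fin p → ℝ} (hκ : Tendsto κ atTop (𝓝 κ₀))
    (hs : ∀ j, Tendsto (fun N => s N j) atTop (𝓝 (s₀ j)))
    (hs' : ∀ j, Tendsto (fun N => s' N j) atTop (𝓝 (s₀' j))) :
    Tendsto (fun N => perturbationEntry σ (κ N) d (s N) (s' N) a a') atTop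
      (𝓝 (perturbationEntry σ κ₀ d s₀ s₀' a a')) := by
  unfold perturbationEntry
  refine Tendsto.const_mul _ (((Tendsto.sub ?_ (hκ.const_mul _)).add
    (Tendsto.const_mul _ (Tendsto.add ?_ ?_))).add tendsto_const_nhds)
  · exact tendsto_finsetSum _ fun j _ => (hs j).mul (hs' j)
  · exact tendsto_finsetSum _ fun j _ => (hs j).mul_const _
  · exact tendsto_finsetSum _ fun j _ => (hs' j).mul_const _

end Limit

/-! ### Convergence and second moments at the random latent points. -/

section Model

variable {Ω Z : Type*} [MeasurableSpace Ω] {P : Measure Ω} [IsProbabilityMeasure P]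
  [MetricSpace Z] [CompactSpace Z] [MeasurableSpace Z] [BorelSpace Z]
  {μ : Measure Z} [IsProbabilityMeasure μ] {n p : ℕ}
  {z : Fin n → Ω → Z} {ψ : Fin p → Ω → Z → ℝ} {E : Fin n → Fin p → Ω → ℝ}
  {lam : ℕ → ℝ} {e : ℕ → Z → ℝ} {σ M : ℝ}

/-- Up to a null set, which independence ignores, the coefficients are measurable functions `G j k`
of the paths. -/
theorem IsLatentMetricModel.indepFun_latent_coeffNoise (hmodel : IsLatentMetricModel P μ z ψ E)
    (hcont : MeanSquareContinuous P ψ) (hψ : IsBoundedProcess P ψ M)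
    (hem : ∀ k, Measurable (e k)) (he2 : ∀ k, MemLp (e k) 2 μ) :
    IndepFun (fun ω i => z i ω) (coeffNoise μ ψ E e) P := by
  choose G hG hGe using fun (j : Fin p) (k : ℕ) =>
    exists_measurable_path_integral (hψ.measurable j) (hψ.memLp j) (hψ.integral_sq_le j)
      (fun x => (hcont j x).2) (hem k) (he2 k)
  let Φ : (Fin p → Z → ℝ) × (Fin n → Fin p → ℝ) → (Fin p → ℕ → ℝ) × (Fin n → Fin p → ℝ) :=
    fun q => (fun j k => G j k (q.1 j), q.2)
  have hΦ : Measurable Φ := by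
    refine Measurable.prodMk (measurable_pi_lambda _ fun j => measurable_pi_lambda _ fun k => ?_)
      measurable_snd
    exact (hG j k).comp ((measurable_pi_apply j).comp measurable_fst)
  refine IndepFun.congr (hmodel.indep_z_ψE.comp measurable_id hΦ) EventuallyEq.rfl ?_
  have hall : ∀ᵐ ω ∂P, ∀ j k, ∫ x, ψ j ω x * e k x ∂μ = G j k (ψ j ω) :=
    ae_all_iff.2 fun j => ae_all_iff.2 fun k => hGe j k
  filter_upwards [hall] with ω hω
  simp only [Function.comp_apply, Φ, coeffNoise, hω]

theorem IsExpansionPoint.ae_tendsto_coeffSum {f : Z → Z → ℝ} (hψ : IsBoundedProcess P ψ M)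
    (he : IsEigenbasis μ f lam e) {x : Z}
    (hx : IsExpansionPoint P μ ψ e x) :
    ∀ᵐ ω ∂P, ∀ j, coeffSum e ((coeffNoise μ ψ E e ω).1 j) x = ψ j ω x ∧
      Tendsto (fun N => ∑ k ∈ Finset.range N, (coeffNoise μ ψ E e ω).1 j k * e k x) atTop
        (𝓝 (coeffSum e ((coeffNoise μ ψ E e ω).1 j) x)) := by
  filter_upwards [ae_all_iff.2 fun j => hx.ae_tendsto_partialSum hψ he j] with ω hω j
  have h : Tendsto (fun N => ∑ k ∈ Finset.range N, (coeffNoise μ ψ E e ω).1 j k * e k x) atTop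
      (𝓝 (ψ j ω x)) := hω j
  have h2 : coeffSum e ((coeffNoise μ ψ E e ω).1 j) x = ψ j ω x := h.limsup_eq
  exact ⟨h2, h2 ▸ h⟩

theorem IsLatentMetricModel.ae_isExpansionPoint (hmodel : IsLatentMetricModel P μ z ψ E)
    (hp : 0 < p) (hψ : IsBoundedProcess P ψ M) (he : IsEigenbasis μ (implicitKernel P ψ) lam e)
    (hdecay : Summable fun k : ℕ => ((k : ℝ) + 1) * lam k) :
    ∀ᵐ ω ∂P, ∀ i, IsExpansionPoint P μ ψ e (z i ω) := by
  refine ae_all_iff.2 fun i => ?_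
  have : Fact ((2 : ℝ≥0∞) ≠ ∞) := ⟨by norm_num⟩
  have h := he.ae_isExpansionPoint hp hψ hdecay
  -- This also rewrites the `μ` inside `IsExpansionPoint`; the last line restores it.
  rw [← hmodel.law_z i] at h
  have h2 := ae_of_ae_map (hmodel.measurable_z i).aemeasurable h
  rwa [hmodel.law_z i] at h2

theorem IsLatentMetricModel.ae_tendsto_DeltaTrunc (hmodel : IsLatentMetricModel P μ z ψ E)
    (hcont : MeanSquareContinuous P ψ) (hp : 0 < p) (hψ : IsBoundedProcess P ψ M) {u : ℕ → Z → ℝ}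
    (he : IsEigenbasis μ (implicitKernel P ψ) lam (eigenfunction lam u))
    (hdecay : Summable fun k : ℕ => ((k : ℝ) + 1) * lam k) :
    ∀ᵐ ω ∂P, ∀ i i', Tendsto (fun N => DeltaTrunc μ z ψ E σ lam u N ω i i') atTop
      (𝓝 (limitMatrix (implicitKernel P ψ) (eigenfunction lam u) σ
        (fun i => z i ω, coeffNoise μ ψ E (eigenfunction lam u) ω) i i')) := by
  set e := eigenfunction lam u
  have hgood := hmodel.ae_isExpansionPoint hp hψ he hdecay
  -- At a fixed point the exceptional null set depends on the point. Convergence is stated through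
  -- coefficients, so that `Q` is measurable and independence carries it over to random points.
  let Q : Set ((Fin n → Z) × (Fin p → ℕ → ℝ) × (Fin n → Fin p → ℝ)) :=
    {q | ∀ i j, Tendsto (fun N => ∑ k ∈ Finset.range N, q.2.1 j k * e k (q.1 i)) atTop
      (𝓝 (coeffSum e (q.2.1 j) (q.1 i)))}
  have hQ : MeasurableSet Q := by
    simp only [Q, Set.ofPred_forall]
    refine MeasurableSet.iInter fun i => MeasurableSet.iInter fun j => ?_
    have h1 : Measurable fun q : (Fin n → Z) × (Fin p → ℕ → ℝ) × (Fin n → Fin p → ℝ) =>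
        q.2.1 j := by fun_prop
    have h2 : Measurable fun q : (Fin n → Z) × (Fin p → ℕ → ℝ) × (Fin n → Fin p → ℝ) =>
        q.1 i := by fun_prop
    exact measurableSet_tendsto_fun (fun N => measurable_coeff_partial he.measurable h1 h2 N)
      (measurable_coeffSum he.measurable h1 h2)
  have hmem := ae_of_indepFun hmodel.measurable_latent
    (hmodel.measurable_coeffNoise he.measurable)
    (hmodel.indepFun_latent_coeffNoise hcont hψ he.measurable he.memLp) hQ (by
      filter_upwards [hgood] with ω' hω'
      filter_upwards [ae_all_iff.2 fun i => (hω' i).ae_tendsto_coeffSum (E := E) hψ he] with ω hω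
      exact fun i j => (hω i j).2)
  filter_upwards [hgood, hmem] with ω h1 h2 i i'
  simp_rw [DeltaTrunc_apply he.nonneg hp]
  exact tendsto_perturbationEntry (he.tendsto_sum_eigenfunctions hp hψ (h1 i) (h1 i'))
    (fun j => h2 i j) fun j => h2 i' j

theorem IsLatentMetricModel.ae_lintegral_limitMatrix_sq_le
    (hmodel : IsLatentMetricModel P μ z ψ E) (hm : FourthMoments P ψ E) (hindep : iIndepFun ψ P)
    (hp : 0 < p) (hψ : IsBoundedProcess P ψ M)
    (he : IsEigenbasis μ (implicitKernel P ψ) lam e)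
    (hdecay : Summable fun k : ℕ => ((k : ℝ) + 1) * lam k) (i i' : Fin n) :
    ∀ᵐ ω' ∂P, ∫⁻ ω, ENNReal.ofReal (limitMatrix (implicitKernel P ψ) e σ
        (fun i => z i ω', coeffNoise μ ψ E e ω) i i' ^ 2) ∂P
      ≤ ENNReal.ofReal (3 * (v₁ P ψ + 4 * σ ^ 2 * v₂ P ψ + σ ^ 4 * v₃ P E) / p) := by
  filter_upwards [hmodel.ae_isExpansionPoint hp hψ he hdecay] with ω' hω'
  refine le_trans (le_of_eq (lintegral_congr_ae ?_))
    (hmodel.lintegral_perturbationEntry_sq_le hp hm hindep σ (z i ω') (z i' ω') i i')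
  filter_upwards [(hω' i).ae_tendsto_coeffSum (E := E) hψ he,
    (hω' i').ae_tendsto_coeffSum (E := E) hψ he] with ω h1 h2
  simp only [limitMatrix, fun j => (h1 j).1, fun j => (h2 j).1]
  rfl

end Model

/-! ### Smallest eigenvalue and spectral norm. -/

section Matrix

variable {n : ℕ}

/-- Both sides say that B − t I is positive semidefinite, by its spectrum and by its quadratic form.
-/
theorem le_smallest_eigenvalue_iff (hn : 0 < n) {B : Matrix (Fin n) (Fin n) ℝ}
    (hB : B.IsHermitian) (t : ℝ) :
    t ≤ eigenvalueNth hB n ⟨hn, le_rfl⟩ ↔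
      ∀ v : Fin n → ℝ, t * ∑ i, v i * v i ≤ ∑ i, v i * ∑ j, B i j * v j := by
  have hH : (B - algebraMap ℝ (Matrix (Fin n) (Fin n) ℝ) t).IsHermitian := by
    refine hB.sub ?_
    rw [Algebra.algebraMap_eq_smul_one]
    exact Matrix.isHermitian_one.smul (by simp [IsSelfAdjoint])
  have h1 : t ≤ eigenvalueNth hB n ⟨hn, le_rfl⟩ ↔
      (B - algebraMap ℝ (Matrix (Fin n) (Fin n) ℝ) t).PosSemidef := by
    rw [Matrix.posSemidef_iff_isHermitian_and_spectrum_nonneg, and_iff_right hH,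
      ← spectrum.sub_singleton_eq, hB.spectrum_real_eq_range_eigenvalues]
    constructor
    · rintro h _ ⟨_, ⟨i, rfl⟩, _, rfl, rfl⟩
      simp only [Set.mem_ofPred_eq, sub_nonneg]
      refine h.trans (hB.eigenvalues₀_antitone ?_)
      rw [Fin.le_def]
      have := ((Fintype.equivOfCardEq (Fintype.card_fin (Fintype.card (Fin n)))).symm i).isLt
      exact Nat.le_sub_one_of_lt (this.trans_eq (Fintype.card_fin n))
    · intro h
      have h2 := h (Set.sub_mem_sub (Set.mem_range_self
        (Fintype.equivOfCardEq (Fintype.card_fin (Fintype.card (Fin n)))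
          (⟨n - 1, by rw [Fintype.card_fin]; omega⟩))) (Set.mem_singleton t))
      simp only [Set.mem_ofPred_eq, sub_nonneg, Matrix.IsHermitian.eigenvalues,
        Equiv.symm_apply_apply] at h2
      exact h2
  rw [h1, Matrix.posSemidef_iff_dotProduct_mulVec, and_iff_right hH]
  refine forall_congr' fun v => ?_
  rw [Matrix.sub_mulVec, dotProduct_sub, sub_nonneg, Algebra.algebraMap_eq_smul_one,
    Matrix.smul_mulVec, Matrix.one_mulVec, dotProduct_smul, smul_eq_mul]
  simp only [dotProduct, Matrix.mulVec, star_trivial]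

/-- The matrices with smallest eigenvalue at least t form an intersection of closed half-spaces, one
for each vector. -/
theorem measurable_smallest_eigenvalue (hn : 0 < n) {α : Type*} [MeasurableSpace α]
    {B : α → Matrix (Fin n) (Fin n) ℝ} (hB : ∀ a, (B a).IsHermitian)
    (hm : ∀ i j, Measurable fun a => B a i j) :
    Measurable fun a => eigenvalueNth (hB a) n ⟨hn, le_rfl⟩ := by
  refine measurable_of_Ici fun t => ?_
  have hcl : IsClosed {C : Fin n → Fin n → ℝ |
      ∀ v : Fin n → ℝ, t * ∑ i, v i * v i ≤ ∑ i, v i * ∑ j, C i j * v j} := by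
    simp only [Set.ofPred_forall]
    exact isClosed_iInter fun v => isClosed_le continuous_const (by fun_prop)
  have hmeas : Measurable fun a i j => B a i j :=
    measurable_pi_lambda _ fun i => measurable_pi_lambda _ fun j => hm i j
  have := hmeas hcl.measurableSet
  convert this using 1
  ext a
  exact le_smallest_eigenvalue_iff hn (hB a) t

theorem spectralNorm_nonneg (B : Matrix (Fin n) (Fin n) ℝ) : 0 ≤ spectralNorm B := norm_nonneg _

theorem spectralNorm_sq_le (B : Matrix (Fin n) (Fin n) ℝ) :
    spectralNorm B ^ 2 ≤ ∑ i, ∑ j, B i j ^ 2 := by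
  have h0 : 0 ≤ ∑ i, ∑ j, B i j ^ 2 :=
    Finset.sum_nonneg fun i _ => Finset.sum_nonneg fun j _ => sq_nonneg _
  rw [← Real.sq_sqrt h0]
  gcongr
  · exact spectralNorm_nonneg B
  refine ContinuousLinearMap.opNorm_le_bound _ (Real.sqrt_nonneg _) fun x => ?_
  rw [EuclideanSpace.norm_eq, EuclideanSpace.norm_eq, ← Real.sqrt_mul h0]
  apply Real.sqrt_le_sqrt
  simp only [Real.norm_eq_abs, sq_abs]
  rw [Finset.sum_mul]
  exact Finset.sum_le_sum fun i _ =>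
    Finset.sum_mul_sq_le_sq_mul_sq Finset.univ (fun j => B i j) fun j => x j

theorem continuous_spectralNorm :
    Continuous fun B : Fin n → Fin n → ℝ => spectralNorm (Matrix.of B) := by
  let T : (Fin n → Fin n → ℝ) →ₗ[ℝ] (EuclideanSpace ℝ (Fin n) →L[ℝ] EuclideanSpace ℝ (Fin n)) :=
    { toFun := fun B => Matrix.toEuclideanCLM (n := Fin n) (𝕜 := ℝ) (Matrix.of B)
      map_add' := fun B C => map_add (Matrix.toEuclideanCLM (n := Fin n) (𝕜 := ℝ)) _ _
      map_smul' := fun c B => map_smul (Matrix.toEuclideanCLM (n := Fin n) (𝕜 := ℝ)) c _ }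
  exact T.continuous_of_finiteDimensional.norm

end Matrix

/-! ### Conditional Chebyshev inequality and its integrated form. -/

section Conditional

variable {Ω α : Type*} {mΩ : MeasurableSpace Ω} [MeasurableSpace α]
  {P : Measure Ω} [IsProbabilityMeasure P] {U : Ω → α}

theorem condExp_le_const_of_setIntegral_le {m : MeasurableSpace Ω} (hm : m ≤ mΩ) {g : Ω → ℝ}
    (hg : Integrable g P) {V : ℝ} (h : ∀ s, MeasurableSet[m] s → ∫ ω in s, g ω ∂P ≤ V * P.real s) :
    ∀ᵐ ω ∂P, (P[g|m]) ω ≤ V := by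
  refine ae_le_of_ae_le_trim (hm := hm) (f₁ := P[g|m]) (f₂ := fun _ => V) ?_
  refine ae_le_of_forall_setIntegral_le (integrable_condExp.trim hm stronglyMeasurable_condExp)
    (integrable_const _) fun s hs _ => ?_
  rw [← setIntegral_trim hm stronglyMeasurable_condExp hs, setIntegral_condExp hm hg hs,
    setIntegral_const, smul_eq_mul, mul_comm, measureReal_def, trim_measurableSet_eq hm hs,
    ← measureReal_def]
  exact h s hs

/-- A conditional Chebyshev inequality: if `ρ² ≤ g` on `C` and the conditional expectation of
`g` is at most `V`, then the conditional probability of `C` is at most `V / ρ²`. -/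
theorem condExp_indicator_le_div_sq {m : MeasurableSpace Ω} (hm : m ≤ mΩ) {g ρ : Ω → ℝ}
    (hg : Integrable g P) (hg0 : ∀ ω, 0 ≤ g ω) {V : ℝ} (hV : ∀ᵐ ω ∂P, (P[g|m]) ω ≤ V)
    (hρ : Measurable[m] ρ) {C : Set Ω} (hC : MeasurableSet[mΩ] C)
    (hCg : ∀ ω ∈ C, 0 < ρ ω → ρ ω ^ 2 ≤ g ω) :
    ∀ᵐ ω ∂P, 0 < ρ ω → (P⟦C|m⟧) ω ≤ V / ρ ω ^ 2 := by
  -- The weight ρ², cut off where ρ ≤ 0, is `m`-measurable and so leaves the conditional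
  -- expectation, while `w` times the indicator of `C` stays below `g` everywhere.
  let w : Ω → ℝ := {ω | 0 < ρ ω}.indicator fun ω => ρ ω ^ 2
  have hw : StronglyMeasurable[m] w :=
    ((hρ.pow_const 2).stronglyMeasurable).indicator (measurableSet_lt measurable_const hρ)
  have hi1 : Integrable (C.indicator fun _ => (1 : ℝ)) P := (integrable_const 1).indicator hC
  have hle : ∀ ω, (w * C.indicator fun _ => (1 : ℝ)) ω ≤ g ω := by
    intro ω
    by_cases h1 : ω ∈ C <;> by_cases h2 : 0 < ρ ω <;>
      simp [w, Set.indicator, h1, h2, hg0 ω, hCg ω]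
  have h0 : ∀ ω, 0 ≤ (w * C.indicator fun _ => (1 : ℝ)) ω := by
    intro ω
    by_cases h1 : ω ∈ C <;> by_cases h2 : 0 < ρ ω <;> simp [w, Set.indicator, h1, h2, sq_nonneg]
  have hi2 : Integrable (w * C.indicator fun _ => (1 : ℝ)) P := by
    refine hg.mono' ((hw.mono hm).aestronglyMeasurable.mul hi1.aestronglyMeasurable)
      (.of_forall fun ω => ?_)
    rw [Real.norm_of_nonneg (h0 ω)]
    exact hle ω
  filter_upwards [hV, condExp_mono (m := m) hi2 hg (.of_forall hle),
    condExp_mul_of_stronglyMeasurable_left hw hi2 hi1] with ω a1 a2 a3 hpos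
  rw [a3] at a2
  have hwω : w ω = ρ ω ^ 2 := Set.indicator_of_mem (s := {ω | 0 < ρ ω}) hpos _
  rw [le_div_iff₀ (by positivity), ← hwω, mul_comm]
  exact a2.trans a1

theorem measureReal_inter_le_of_condExp_le {m : MeasurableSpace Ω} (hm : m ≤ mΩ) {C s : Set Ω}
    (hC : MeasurableSet[mΩ] C) (hs : MeasurableSet[m] s) {b : ℝ}
    (h : ∀ᵐ ω ∂P, ω ∈ s → (P⟦C|m⟧) ω ≤ b) : P.real (C ∩ s) ≤ b * P.real s := by
  have hi1 : Integrable (C.indicator fun _ => (1 : ℝ)) P := (integrable_const 1).indicator hC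
  calc P.real (C ∩ s) = ∫ ω in s, C.indicator (fun _ => (1 : ℝ)) ω ∂P := by
        rw [setIntegral_indicator hC, setIntegral_const, smul_eq_mul, mul_one, Set.inter_comm]
    _ = ∫ ω in s, (P⟦C|m⟧) ω ∂P := (setIntegral_condExp hm hi1 hs).symm
    _ ≤ ∫ _ω in s, b ∂P :=
        setIntegral_mono_on_ae integrable_condExp.integrableOn (integrable_const b).integrableOn
          (hm s hs) h
    _ = b * P.real s := by rw [setIntegral_const, smul_eq_mul, mul_comm]

end Conditional

/-! ### Measurability of the smallest eigenvalue in the latent variables. -/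

section Tail

variable {Ω Z : Type*} [MeasurableSpace Z] {n : ℕ} {z : Fin n → Ω → Z} {lam : ℕ → ℝ}
  {u : ℕ → Z → ℝ}

theorem measurable_muTail (hn : 0 < n) (hlam : ∀ k, 0 ≤ lam k)
    (hu : ∀ k, Measurable (eigenfunction lam u k)) (k : ℕ) :
    Measurable[sigmaZ z] fun ω => muTail hn z lam u k ω := by
  have h : Measurable fun x : Fin n → Z => muTail hn (fun i (x : Fin n → Z) => x i) lam u k x := by
    refine measurable_smallest_eigenvalue hn (fun x => KTail_isHermitian _ lam u k x) fun i j => ?_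
    simp only [KTail, Matrix.of_apply, feature_mul_feature hlam]
    exact Measurable.tsum fun l => (((hu _).comp (measurable_pi_apply i)).mul
      ((hu _).comp (measurable_pi_apply j))).const_mul _
  exact h.comp (comap_measurable fun ω i => z i ω)

end Tail

/-! ### Conditional second moment of the Frobenius norm of Δ. -/

section Perturbation

theorem integrable_and_setIntegral_le_of_setLIntegral_le {Ω : Type*} [MeasurableSpace Ω]
    {P : Measure Ω} [IsProbabilityMeasure P] {g : Ω → ℝ} (hg : Measurable g) (hg0 : ∀ ω, 0 ≤ g ω)
    {V : ℝ} (hV : 0 ≤ V) {S : Set (Set Ω)} (huniv : Set.univ ∈ S)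
    (h : ∀ s ∈ S, ∫⁻ ω in s, ENNReal.ofReal (g ω) ∂P ≤ ENNReal.ofReal V * P s) :
    Integrable g P ∧ ∀ s ∈ S, ∫ ω in s, g ω ∂P ≤ V * P.real s := by
  constructor
  · refine ⟨hg.aestronglyMeasurable, ?_⟩
    rw [hasFiniteIntegral_iff_ofReal (.of_forall hg0)]
    have := h _ huniv
    rw [Measure.restrict_univ, measure_univ, mul_one] at this
    exact this.trans_lt ENNReal.ofReal_lt_top
  · intro s hs
    rw [integral_eq_lintegral_of_nonneg_ae (.of_forall hg0) hg.aestronglyMeasurable,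
      ← ENNReal.toReal_ofReal hV, measureReal_def, ← ENNReal.toReal_mul]
    exact ENNReal.toReal_mono
      (ENNReal.mul_ne_top ENNReal.ofReal_ne_top (measure_ne_top P s)) (h s hs)

variable {Ω Z : Type*} [MeasurableSpace Ω] {P : Measure Ω} [IsProbabilityMeasure P]
  [MetricSpace Z] [CompactSpace Z] [MeasurableSpace Z] [BorelSpace Z]
  {μ : Measure Z} [IsProbabilityMeasure μ] {n p : ℕ}
  {z : Fin n → Ω → Z} {ψ : Fin p → Ω → Z → ℝ} {E : Fin n → Fin p → Ω → ℝ}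
  {lam : ℕ → ℝ} {e : ℕ → Z → ℝ} {σ M : ℝ}

/-- The limit of the matrices `DeltaTrunc`, as a measurable function of the sample. -/
def limitDelta (P : Measure Ω) (μ : Measure Z) (z : Fin n → Ω → Z) (ψ : Fin p → Ω → Z → ℝ)
    (E : Fin n → Fin p → Ω → ℝ) (e : ℕ → Z → ℝ) (σ : ℝ) (ω : Ω) (i i' : Fin n) : ℝ :=
  limitMatrix (implicitKernel P ψ) e σ (fun i => z i ω, coeffNoise μ ψ E e ω) i i'

theorem IsLatentMetricModel.measurable_limitDelta (hmodel : IsLatentMetricModel P μ z ψ E)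
    (hψ : IsBoundedProcess P ψ M) (he : ∀ k, Measurable (e k)) (i i' : Fin n) :
    Measurable fun ω => limitDelta P μ z ψ E e σ ω i i' :=
  (measurable_limitMatrix hψ.measurable_implicitKernel he i i').comp
    (hmodel.measurable_latent.prodMk (hmodel.measurable_coeffNoise he))

theorem IsLatentMetricModel.sigmaZ_le (hmodel : IsLatentMetricModel P μ z ψ E) :
    sigmaZ z ≤ ‹MeasurableSpace Ω› := hmodel.measurable_latent.comap_le

theorem IsLatentMetricModel.limitDelta_sq_bounds (hmodel : IsLatentMetricModel P μ z ψ E)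
    (hcont : MeanSquareContinuous P ψ) (hm : FourthMoments P ψ E) (hindep : iIndepFun ψ P)
    (hp : 0 < p) (hψ : IsBoundedProcess P ψ M)
    (he : IsEigenbasis μ (implicitKernel P ψ) lam e)
    (hdecay : Summable fun k : ℕ => ((k : ℝ) + 1) * lam k) (i i' : Fin n) :
    Integrable (fun ω => limitDelta P μ z ψ E e σ ω i i' ^ 2) P ∧
      ∀ s ∈ {s | MeasurableSet[sigmaZ z] s}, ∫ ω in s, limitDelta P μ z ψ E e σ ω i i' ^ 2 ∂P
        ≤ 3 * (v₁ P ψ + 4 * σ ^ 2 * v₂ P ψ + σ ^ 4 * v₃ P E) / p * P.real s := by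
  have hv₁ := v₁_nonneg (P := P) (ψ := ψ)
  have hv₂ := v₂_nonneg (P := P) (ψ := ψ)
  have hv₃ := v₃_nonneg (P := P) (E := E)
  refine integrable_and_setIntegral_le_of_setLIntegral_le
    ((hmodel.measurable_limitDelta hψ he.measurable i i').pow_const 2) (fun ω => sq_nonneg _)
    (by positivity) (MeasurableSet.univ (m := sigmaZ z)) ?_
  rintro _ ⟨A, hA, rfl⟩
  exact setLIntegral_comp_le_of_indepFun hmodel.measurable_latent
    (hmodel.measurable_coeffNoise he.measurable)
    (hmodel.indepFun_latent_coeffNoise hcont hψ he.measurable he.memLp)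
    (F := fun q => ENNReal.ofReal (limitMatrix (implicitKernel P ψ) e σ q i i' ^ 2))
    ((measurable_limitMatrix hψ.measurable_implicitKernel he.measurable i i').pow_const
      2).ennreal_ofReal
    (hmodel.ae_lintegral_limitMatrix_sq_le hm hindep hp hψ he hdecay i i') hA

theorem IsLatentMetricModel.condExp_frobenius_le (hmodel : IsLatentMetricModel P μ z ψ E)
    (hcont : MeanSquareContinuous P ψ) (hm : FourthMoments P ψ E) (hindep : iIndepFun ψ P)
    (hp : 0 < p) (hψ : IsBoundedProcess P ψ M)
    (he : IsEigenbasis μ (implicitKernel P ψ) lam e)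
    (hdecay : Summable fun k : ℕ => ((k : ℝ) + 1) * lam k) :
    Integrable (fun ω => 4 * ∑ i, ∑ i', limitDelta P μ z ψ E e σ ω i i' ^ 2) P ∧
      ∀ᵐ ω ∂P, (P[fun ω => 4 * ∑ i, ∑ i', limitDelta P μ z ψ E e σ ω i i' ^ 2|sigmaZ z]) ω
        ≤ 24 * (n : ℝ) ^ 2 / p * (v₁ P ψ + 8 * σ ^ 2 * v₂ P ψ + 2 * σ ^ 4 * v₃ P E) := by
  have hv₁ := v₁_nonneg (P := P) (ψ := ψ)
  have hv₂ := v₂_nonneg (P := P) (ψ := ψ)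
  have hv₃ := v₃_nonneg (P := P) (E := E)
  have hb := fun i i' =>
    hmodel.limitDelta_sq_bounds (σ := σ) hcont hm hindep hp hψ he hdecay i i'
  have hI : Integrable (fun ω => 4 * ∑ i, ∑ i', limitDelta P μ z ψ E e σ ω i i' ^ 2) P :=
    (integrable_finsetSum _ fun i _ => integrable_finsetSum _ fun i' _ => (hb i i').1).const_mul 4
  refine ⟨hI, condExp_le_const_of_setIntegral_le hmodel.sigmaZ_le hI fun s hs => ?_⟩
  set V := v₁ P ψ + 4 * σ ^ 2 * v₂ P ψ + σ ^ 4 * v₃ P E with hVdef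
  calc ∫ ω in s, 4 * ∑ i, ∑ i', limitDelta P μ z ψ E e σ ω i i' ^ 2 ∂P
      = 4 * ∑ i, ∑ i', ∫ ω in s, limitDelta P μ z ψ E e σ ω i i' ^ 2 ∂P := by
        rw [integral_const_mul, integral_finsetSum _ fun i _ =>
          integrable_finsetSum _ fun i' _ => (hb i i').1.integrableOn]
        congr 1
        exact Finset.sum_congr rfl fun i _ =>
          integral_finsetSum _ fun i' _ => (hb i i').1.integrableOn
    _ ≤ 4 * ∑ _i : Fin n, ∑ _i' : Fin n, 3 * V / p * P.real s := by
        gcongr with i _ i' _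
        exact (hb i i').2 s hs
    _ = 12 * (n : ℝ) ^ 2 / p * V * P.real s := by
        simp only [Finset.sum_const, Finset.card_univ, Fintype.card_fin, nsmul_eq_mul]
        ring
    -- The moments give 12 n²/p with weights 1, 4, 1; the stated constants 24 and 1, 8, 2 are
    -- larger.
    _ ≤ _ := by
        have h1 : V ≤ v₁ P ψ + 8 * σ ^ 2 * v₂ P ψ + 2 * σ ^ 4 * v₃ P E := by
          have h2 : 0 ≤ σ ^ 2 * v₂ P ψ := by positivity
          have h3 : 0 ≤ σ ^ 4 * v₃ P E := by positivity
          linarith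
        gcongr
        norm_num

theorem IsLatentMetricModel.ae_tendsto_and_Delta_eq (hmodel : IsLatentMetricModel P μ z ψ E)
    (hcont : MeanSquareContinuous P ψ) (hp : 0 < p) (hψ : IsBoundedProcess P ψ M) {u : ℕ → Z → ℝ}
    (he : IsEigenbasis μ (implicitKernel P ψ) lam (eigenfunction lam u))
    (hdecay : Summable fun k : ℕ => ((k : ℝ) + 1) * lam k) :
    ∀ᵐ ω ∂P, Tendsto (fun N => DeltaTrunc μ z ψ E σ lam u N ω) atTop
        (𝓝 (Delta μ z ψ E σ lam u ω)) ∧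
      Delta μ z ψ E σ lam u ω = Matrix.of (limitDelta P μ z ψ E (eigenfunction lam u) σ ω) := by
  filter_upwards [hmodel.ae_tendsto_DeltaTrunc (σ := σ) hcont hp hψ he hdecay] with ω hω
  have h : Delta μ z ψ E σ lam u ω
      = Matrix.of (limitDelta P μ z ψ E (eigenfunction lam u) σ ω) := by
    ext i i'
    exact (hω i i').limUnder_eq
  refine ⟨?_, h⟩
  rw [h]
  exact tendsto_pi_nhds.2 fun i => tendsto_pi_nhds.2 fun i' => hω i i'

end Perturbation

end LMM

end

theorem proposition2
    {Ω Z : Type*} [MeasurableSpace Ω] (P : Measure Ω) [IsProbabilityMeasure P]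
    [MetricSpace Z] [CompactSpace Z] [MeasurableSpace Z] [BorelSpace Z]
    (μ : Measure Z) [IsProbabilityMeasure μ] [μ.IsOpenPosMeasure]
    (n p : ℕ) (hn : 0 < n) (hp : 0 < p)
    (z : Fin n → Ω → Z) (ψ : Fin p → Ω → Z → ℝ) (E : Fin n → Fin p → Ω → ℝ)
    (hmodel : LMM.IsLatentMetricModel P μ z ψ E)
    (hcont : LMM.MeanSquareContinuous P ψ)
    (hmoments : LMM.FourthMoments P ψ E)
    (hindep : iIndepFun ψ P)
    (lam : ℕ → ℝ) (u : ℕ → Z → ℝ)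
    (heig : LMM.IsEigensystem μ (LMM.implicitKernel P ψ) lam u)
    (hdecay : Summable fun k : ℕ => ((k : ℝ) + 1) * lam k)
    (σ γ : ℝ) (hσ : 0 ≤ σ) (hγ : 0 ≤ γ)
    (k : ℕ) (hk : k ≤ n) :
    -- the infinite products in `Δ` converge almost surely, and `C` is an event
    (∀ᵐ ω ∂P, Tendsto (fun N => LMM.DeltaTrunc μ z ψ E σ lam u N ω) atTop
      (𝓝 (LMM.Delta μ z ψ E σ lam u ω))) ∧
    NullMeasurableSet (LMM.eventC hn μ z ψ E σ γ lam u k) P ∧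
    -- the bound on the conditional probability of `C` given the latent variables
    (∀ᵐ ω ∂P, 0 < LMM.muTail hn z lam u k ω + σ ^ 2 + n * γ →
      (P⟦LMM.eventC hn μ z ψ E σ γ lam u k|LMM.sigmaZ z⟧) ω ≤
        24 * (n : ℝ) ^ 2 / p *
          ((LMM.v₁ P ψ + 8 * σ ^ 2 * LMM.v₂ P ψ + 2 * σ ^ 4 * LMM.v₃ P E) /
            (LMM.muTail hn z lam u k ω + σ ^ 2 + n * γ) ^ 2)) ∧
    -- the unconditional bound
    (∀ φ : ℝ, 0 ≤ φ → 0 < φ + σ ^ 2 + n * γ →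
      1 - P.real (LMM.eventC hn μ z ψ E σ γ lam u k) ≥
        (1 - 24 * (n : ℝ) ^ 2 / p *
          ((LMM.v₁ P ψ + 8 * σ ^ 2 * LMM.v₂ P ψ + 2 * σ ^ 4 * LMM.v₃ P E) /
            (φ + σ ^ 2 + n * γ) ^ 2)) *
          P.real {ω | φ ≤ LMM.muTail hn z lam u k ω}) := by
  obtain ⟨M, hψ⟩ := hmoments.isBoundedProcess hmodel.measurable_ψ
  have he := heig.isEigenbasis hψ.measurable_implicitKernel
  have hm := hmodel.sigmaZ_le
  set D := LMM.limitDelta P μ z ψ E (LMM.eigenfunction lam u) σ with hD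
  have hDm : Measurable D := measurable_pi_lambda _ fun i => measurable_pi_lambda _ fun i' =>
    hmodel.measurable_limitDelta hψ he.measurable i i'
  have hmu : Measurable[LMM.sigmaZ z] fun ω => LMM.muTail hn z lam u k ω :=
    LMM.measurable_muTail hn he.nonneg he.measurable k
  have hρ : Measurable[LMM.sigmaZ z] fun ω => LMM.muTail hn z lam u k ω + σ ^ 2 + n * γ :=
    (hmu.add_const _).add_const _
  have hlim := hmodel.ae_tendsto_and_Delta_eq (σ := σ) hcont hp hψ he hdecay
  -- `Delta` takes unspecified values where the limits fail to exist, so the event is replaced by an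
  -- almost surely equal set that is measurable.
  let C : Set Ω := {ω | LMM.muTail hn z lam u k ω + σ ^ 2 + n * γ
    ≤ 2 * LMM.spectralNorm (Matrix.of (D ω))}
  have hC : MeasurableSet C := measurableSet_le (hρ.mono hm le_rfl)
    ((LMM.continuous_spectralNorm.measurable.comp hDm).const_mul 2)
  have hCae : LMM.eventC hn μ z ψ E σ γ lam u k =ᵐ[P] C := by
    filter_upwards [hlim] with ω hω
    refine propext ?_
    change _ ≤ 2 * LMM.spectralNorm (LMM.Delta μ z ψ E σ lam u ω) ↔ _
    rw [hω.2]
    rfl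
  obtain ⟨hI, hV⟩ :=
    hmodel.condExp_frobenius_le (σ := σ) hcont hmoments hindep hp hψ he hdecay
  set V := LMM.v₁ P ψ + 8 * σ ^ 2 * LMM.v₂ P ψ + 2 * σ ^ 4 * LMM.v₃ P E with hVdef
  have hV0 : 0 ≤ 24 * (n : ℝ) ^ 2 / p * V := by
    have hv₁ := LMM.v₁_nonneg (P := P) (ψ := ψ)
    have hv₂ := LMM.v₂_nonneg (P := P) (ψ := ψ)
    have hv₃ := LMM.v₃_nonneg (P := P) (E := E)
    positivity
  -- Chebyshev is applied with g = 4‖D‖_F², which dominates (2‖D‖₂)².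
  have hcond := LMM.condExp_indicator_le_div_sq hm hI
    (fun ω => mul_nonneg zero_le_four (Finset.sum_nonneg fun i _ =>
      Finset.sum_nonneg fun i' _ => sq_nonneg _)) hV hρ hC (fun ω hω hpos => by
        have h1 := LMM.spectralNorm_sq_le (Matrix.of (D ω))
        have h2 : LMM.muTail hn z lam u k ω + σ ^ 2 + n * γ
          ≤ 2 * LMM.spectralNorm (Matrix.of (D ω)) := hω
        calc (LMM.muTail hn z lam u k ω + σ ^ 2 + n * γ) ^ 2
            ≤ (2 * LMM.spectralNorm (Matrix.of (D ω))) ^ 2 := by gcongr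
          _ = 4 * LMM.spectralNorm (Matrix.of (D ω)) ^ 2 := by ring
          _ ≤ _ := mul_le_mul_of_nonneg_left h1 zero_le_four)
  refine ⟨hlim.mono fun ω hω => hω.1, hC.nullMeasurableSet.congr hCae.symm, ?_, ?_⟩
  · filter_upwards [hcond, condExp_congr_ae (m := LMM.sigmaZ z)
      (indicator_ae_eq_of_ae_eq_set (f := fun _ => (1 : ℝ)) hCae)] with ω h1 h2 hpos
    rw [h2, ← mul_div_assoc]
    exact h1 hpos
  · intro φ hφ hφpos
    have hs : MeasurableSet[LMM.sigmaZ z] {ω | φ ≤ LMM.muTail hn z lam u k ω} :=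
      measurableSet_le measurable_const hmu
    have hle := LMM.measureReal_inter_le_of_condExp_le (P := P) hm hC hs
      (b := 24 * (n : ℝ) ^ 2 / p * V / (φ + σ ^ 2 + n * γ) ^ 2) (by
        filter_upwards [hcond] with ω h1 hω
        have h2 : φ ≤ LMM.muTail hn z lam u k ω := hω
        refine (h1 (by linarith)).trans ?_
        gcongr)
    rw [measureReal_congr hCae, ← probReal_compl_eq_one_sub hC, ← mul_div_assoc]
    -- With s = {φ ≤ μ_n} and b the bound on s: P(Cᶜ) ≥ P(s \ C) = P(s) − P(s ∩ C) ≥ (1 − b) P(s).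
    have hsplit := measureReal_inter_add_sdiff (μ := P)
      (s := {ω | φ ≤ LMM.muTail hn z lam u k ω}) hC
    have hsub : P.real ({ω | φ ≤ LMM.muTail hn z lam u k ω} \ C) ≤ P.real Cᶜ :=
      measureReal_mono fun ω hω => hω.2
    rw [Set.inter_comm] at hsplit
    linarith
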